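/- Let $SYT_m$ denote the set of standard Young tableaux with $m$ cells (English notation), filled with $1,\dots,m$. For $w=w_1\cdots w_n\in S_n$ let $I(w)\in SYT_n$ be its RSK (row) insertion tableau, and for $T\in SYT_n$ let $\mathcal Y_T=\{w\in S_n : I(w)=T\}$ be its Knuth class. The right weak order $\le_{weak}$ on $S_n$ is the reflexive transitive closure of the relations $u\le_{weak} us_i$ with $\ell(us_i)=\ell(u)+1$, where $s_i=(i,i+1)$ and $\ell(w)$ is the length of a reduced word of $w$. The weak order $\le_{weak}$ on $SYT_n$ is the transitive closure of the relation: $S\le_{weak} T$ if there are $\sigma\in\mathcal Y_S$ and $\tau\in\mathcal Y_T$ with $\sigma\le_{weak}\tau$. For $1\le k<n$ and $R\in SYT_k$ let $SYT_n^R$ be the set of those $T\in SYT_n$ whose subtableau $T_{[1,k]}$ on the entries $1,\dots,k$ is $R$, with the order induced from the weak order on $SYT_n$. If $R,Q\in SYT_k$ have the same shape, let $\mathcal V_{[R,Q]}\colon SYT_n^R\to SYT_n^Q$ be the map that replaces the subtableau $R$ of $T$ by $Q$ and keeps all other entries. A shape is a hook if each of its cells lies in the first row or in the first column. **Proposition.**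 Let $1\le k<n$ and let $R\in SYT_k$ have hook shape. If $S\lessdot T$ is a covering relation in $SYT_n^R$, then for every $Q\in SYT_k$ of the same shape as $R$, $\mathcal V_{[R,Q]}(S)\lessdot \mathcal V_{[R,Q]}(T)$ is a covering relation in $SYT_n^Q$. -/

import Mathlib

/-! # The weak order on standard Young tableaux and inner tableau translation -/

namespace TableauOrder

/-! ### Standard Young tableaux -/

/-- A standard Young tableau with `n` cells (English convention, rows and columns indexed from `0`):
a Young diagram filled bijectively with `1, …, n`, increasing along rows and down columns.
As for Mathlib's `SemistandardYoungTableau`, the filling is `0` outside the diagram. -/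
@[ext]
structure SYT (n : ℕ) where
  shape : YoungDiagram
  entry : ℕ → ℕ → ℕ
  row_strict : ∀ {i j₁ j₂ : ℕ}, j₁ < j₂ → (i, j₂) ∈ shape → entry i j₁ < entry i j₂
  col_strict : ∀ {i₁ i₂ j : ℕ}, i₁ < i₂ → (i₂, j) ∈ shape → entry i₁ j < entry i₂ j
  zeros : ∀ {i j : ℕ}, (i, j) ∉ shape → entry i j = 0
  bijOn : Set.BijOn (fun c : ℕ × ℕ => entry c.1 c.2) {c | c ∈ shape} (Set.Icc 1 n)

/-- The list of rows of a tableau, from top to bottom, each read from left to right. -/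
def SYT.rows {n : ℕ} (T : SYT n) : List (List ℕ) :=
  (List.range (T.shape.colLen 0)).map fun i => (List.range (T.shape.rowLen i)).map (T.entry i)

/-- A diagram of hook shape: every cell lies in the first row or in the first column. -/
def IsHook (μ : YoungDiagram) : Prop :=
  ∀ i j : ℕ, (i, j) ∈ μ → i = 0 ∨ j = 0

/-! ### Row insertion -/

/-- Insert `x` into an increasing row: `x` replaces the leftmost (that is, smallest) entry greater
than `x`, which is returned as the bumped entry; if there is none, `x` is put at the end. -/
def rowInsert (x : ℕ) : List ℕ → List ℕ × Option ℕ
  | [] => ([x], none)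
  | a :: l => if x < a then (x :: l, some a) else (a :: (rowInsert x l).1, (rowInsert x l).2)

/-- Insert `x` into a tableau given by its rows; bumped entries are inserted into the next row. -/
def tabInsert : ℕ → List (List ℕ) → List (List ℕ)
  | x, [] => [[x]]
  | x, r :: t =>
    match rowInsert x r with
    | (r', none) => r' :: t
    | (r', some b) => r' :: tabInsert b t

/-- The one-line notation `w₁ w₂ … wₙ` of a permutation, with letters `1, …, n`. -/
def word {n : ℕ} (w : Equiv.Perm (Fin n)) : List ℕ :=
  List.ofFn fun i => (w i : ℕ) + 1

/-- The (rows of the) insertion tableau `I(w)`. -/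
def insertionTableau {n : ℕ} (w : Equiv.Perm (Fin n)) : List (List ℕ) :=
  (word w).foldl (fun t x => tabInsert x t) []

/-- The Knuth class of `T`: all permutations whose insertion tableau is `T`. -/
def knuthClass {n : ℕ} (T : SYT n) : Set (Equiv.Perm (Fin n)) :=
  {w | insertionTableau w = T.rows}

/-! ### The right weak order on permutations -/

/-- `s` is an adjacent transposition `(i, i+1)`. -/
def IsAdjacentSwap {n : ℕ} (s : Equiv.Perm (Fin n)) : Prop :=
  ∃ (i : ℕ) (h : i + 1 < n), s = Equiv.swap ⟨i, Nat.lt_of_succ_lt h⟩ ⟨i + 1, h⟩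

/-- The length of a permutation: the size of a reduced word, i.e. of a shortest expression as a
product of adjacent transpositions. -/
noncomputable def permLength {n : ℕ} (w : Equiv.Perm (Fin n)) : ℕ :=
  sInf {m | ∃ l : List (Equiv.Perm (Fin n)),
    (∀ s ∈ l, IsAdjacentSwap s) ∧ l.prod = w ∧ l.length = m}

/-- `w = u · sᵢ` for an adjacent transposition `sᵢ`, with `len w = len u + 1`. -/
def PermWeakStep {n : ℕ} (u w : Equiv.Perm (Fin n)) : Prop :=
  ∃ s, IsAdjacentSwap s ∧ w = u * s ∧ permLength w = permLength u + 1

/-- The right weak order on `Sₙ`. -/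
def PermWeakLE {n : ℕ} : Equiv.Perm (Fin n) → Equiv.Perm (Fin n) → Prop :=
  Relation.ReflTransGen PermWeakStep

/-! ### The weak order on tableaux -/

/-- The relation generating the weak order on tableaux. -/
def TabWeakStep {n : ℕ} (S T : SYT n) : Prop :=
  ∃ σ ∈ knuthClass S, ∃ τ ∈ knuthClass T, PermWeakLE σ τ

/-- The weak order on standard Young tableaux: the transitive closure of `TabWeakStep`.
As in every preorder, `S < T` means `S ≤ T ∧ ¬ T ≤ S`, and `S ⋖ T` means that `S < T` and that
nothing lies strictly between. -/
instance SYT.instPreorder (n : ℕ) : Preorder (SYT n) where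
  le := Relation.ReflTransGen TabWeakStep
  le_refl _ := Relation.ReflTransGen.refl
  le_trans _ _ _ := Relation.ReflTransGen.trans

/-! ### Inner tableaux and inner tableau translation -/

theorem SYT.entry_pos {n : ℕ} (T : SYT n) {i j : ℕ} (h : (i, j) ∈ T.shape) : 1 ≤ T.entry i j :=
  (T.bijOn.mapsTo (show (i, j) ∈ {c | c ∈ T.shape} from h)).1

theorem SYT.entry_le {n : ℕ} (T : SYT n) {i j : ℕ} (h : (i, j) ∈ T.shape) : T.entry i j ≤ n :=
  (T.bijOn.mapsTo (show (i, j) ∈ {c | c ∈ T.shape} from h)).2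

theorem SYT.entry_mono {n : ℕ} (T : SYT n) {i i' j j' : ℕ} (hi : i' ≤ i) (hj : j' ≤ j)
    (h : (i, j) ∈ T.shape) : T.entry i' j' ≤ T.entry i j := by
  have h' : (i, j') ∈ T.shape := T.shape.up_left_mem le_rfl hj h
  have h1 : T.entry i' j' ≤ T.entry i j' := by
    rcases hi.eq_or_lt with rfl | hlt
    · exact le_rfl
    · exact (T.col_strict hlt h').le
  have h2 : T.entry i j' ≤ T.entry i j := by
    rcases hj.eq_or_lt with rfl | hlt
    · exact le_rfl
    · exact (T.row_strict hlt h).le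
  exact h1.trans h2

/-- The cells of `T` with entry at most `k`. -/
def SYT.innerShape {n : ℕ} (T : SYT n) (k : ℕ) : YoungDiagram where
  cells := T.shape.cells.filter fun c => T.entry c.1 c.2 ≤ k
  isLowerSet := by
    rintro ⟨i, j⟩ ⟨i', j'⟩ ⟨hi, hj⟩ h
    simp only [Finset.coe_filter, Set.mem_ofPred_eq, YoungDiagram.mem_cells] at h ⊢
    exact ⟨T.shape.up_left_mem hi hj h.1, (T.entry_mono hi hj h.1).trans h.2⟩

theorem SYT.mem_innerShape {n : ℕ} (T : SYT n) (k : ℕ) {c : ℕ × ℕ} :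
    c ∈ T.innerShape k ↔ c ∈ T.shape ∧ T.entry c.1 c.2 ≤ k := by
  rw [← YoungDiagram.mem_cells]
  simp [SYT.innerShape]

/-- The restriction `T_{[1,k]}` of `T` to the entries `1, …, k`. -/
def SYT.restrict {n k : ℕ} (hk : k ≤ n) (T : SYT n) : SYT k where
  shape := T.innerShape k
  entry i j := if (i, j) ∈ T.innerShape k then T.entry i j else 0
  row_strict {i j₁ j₂} hj h := by
    have h1 : (i, j₁) ∈ T.innerShape k := (T.innerShape k).up_left_mem le_rfl hj.le h
    rw [if_pos h, if_pos h1]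
    exact T.row_strict hj ((T.mem_innerShape k).1 h).1
  col_strict {i₁ i₂ j} hi h := by
    have h1 : (i₁, j) ∈ T.innerShape k := (T.innerShape k).up_left_mem hi.le le_rfl h
    rw [if_pos h, if_pos h1]
    exact T.col_strict hi ((T.mem_innerShape k).1 h).1
  zeros h := if_neg h
  bijOn := by
    refine Set.BijOn.congr (f₁ := fun c : ℕ × ℕ => T.entry c.1 c.2) ⟨?_, ?_, ?_⟩ ?_
    · intro c hc
      have hc' := (T.mem_innerShape k).1 hc
      exact ⟨T.entry_pos hc'.1, hc'.2⟩
    · intro c hc d hd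
      exact T.bijOn.injOn ((T.mem_innerShape k).1 hc).1 ((T.mem_innerShape k).1 hd).1
    · intro m hm
      obtain ⟨c, hc, rfl⟩ := T.bijOn.surjOn (show m ∈ Set.Icc 1 n from ⟨hm.1, hm.2.trans hk⟩)
      exact ⟨c, (T.mem_innerShape k).2 ⟨hc, hm.2⟩, rfl⟩
    · intro c hc
      exact (if_pos (show (c.1, c.2) ∈ T.innerShape k from hc)).symm

/-- `SYT_n^R`: the tableaux with `n` cells whose inner tableau `T_{[1,k]}` is `R`. It carries the
restriction of the weak order on `SYT n`. -/
abbrev SYTWithInner {n k : ℕ} (hk : k ≤ n) (R : SYT k) : Type :=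
  {T : SYT n // T.restrict hk = R}

theorem SYTWithInner.mem_iff {n k : ℕ} {hk : k ≤ n} {R : SYT k} (T : SYTWithInner hk R)
    {c : ℕ × ℕ} : c ∈ R.shape ↔ c ∈ T.1.shape ∧ T.1.entry c.1 c.2 ≤ k := by
  obtain ⟨T, rfl⟩ := T
  exact T.mem_innerShape k

/-- The inner tableau translation map `V_{[R,Q]}`: replace the inner tableau `R` of `T` by the
tableau `Q` of the same shape, and keep all the other entries. -/
def innerTranslate {n k : ℕ} (hk : k ≤ n) {R Q : SYT k} (hRQ : R.shape = Q.shape)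
    (T : SYTWithInner hk R) : SYTWithInner hk Q :=
  have hQ : ∀ {c : ℕ × ℕ}, c ∈ Q.shape ↔ c ∈ T.1.shape ∧ T.1.entry c.1 c.2 ≤ k := by
    intro c
    rw [← hRQ]
    exact T.mem_iff
  have hin : ∀ {c : ℕ × ℕ}, c ∈ T.1.shape → c ∉ Q.shape → k < T.1.entry c.1 c.2 := by
    intro c h1 h2
    by_contra h3
    exact h2 (hQ.2 ⟨h1, not_lt.1 h3⟩)
  let U : SYT n :=
    { shape := T.1.shape
      entry := fun i j => if (i, j) ∈ Q.shape then Q.entry i j else T.1.entry i j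
      row_strict := by
        intro i j₁ j₂ hj h
        by_cases h2 : (i, j₂) ∈ Q.shape
        · rw [if_pos h2, if_pos (Q.shape.up_left_mem le_rfl hj.le h2)]
          exact Q.row_strict hj h2
        · rw [if_neg h2]
          split_ifs with h1
          · exact (Q.entry_le h1).trans_lt (hin h h2)
          · exact T.1.row_strict hj h
      col_strict := by
        intro i₁ i₂ j hi h
        by_cases h2 : (i₂, j) ∈ Q.shape
        · rw [if_pos h2, if_pos (Q.shape.up_left_mem hi.le le_rfl h2)]
          exact Q.col_strict hi h2
        · rw [if_neg h2]
          split_ifs with h1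
          · exact (Q.entry_le h1).trans_lt (hin h h2)
          · exact T.1.col_strict hi h
      zeros := by
        intro i j h
        rw [if_neg (fun h' => h (hQ.1 h').1)]
        exact T.1.zeros h
      bijOn := by
        refine ⟨?_, ?_, ?_⟩
        · rintro ⟨i, j⟩ hc
          by_cases h : (i, j) ∈ Q.shape
          · simp only [if_pos h]
            exact ⟨Q.entry_pos h, (Q.entry_le h).trans hk⟩
          · simp only [if_neg h]
            exact ⟨T.1.entry_pos hc, T.1.entry_le hc⟩
        · rintro ⟨i, j⟩ hc ⟨i', j'⟩ hd hcd
          by_cases h : (i, j) ∈ Q.shape <;> by_cases h' : (i', j') ∈ Q.shape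
          · simp only [if_pos h, if_pos h'] at hcd
            exact Q.bijOn.injOn h h' hcd
          · simp only [if_pos h, if_neg h'] at hcd
            have h1 := Q.entry_le h
            have h2 := hin hd h'
            simp only at h2
            omega
          · simp only [if_neg h, if_pos h'] at hcd
            have h1 := Q.entry_le h'
            have h2 := hin hc h
            simp only at h2
            omega
          · simp only [if_neg h, if_neg h'] at hcd
            exact T.1.bijOn.injOn hc hd hcd
        · intro m hm
          by_cases hmk : m ≤ k
          · obtain ⟨c, hc, rfl⟩ := Q.bijOn.surjOn (show m ∈ Set.Icc 1 k from ⟨hm.1, hmk⟩)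
            exact ⟨c, (hQ.1 hc).1, if_pos hc⟩
          · obtain ⟨c, hc, rfl⟩ := T.1.bijOn.surjOn hm
            exact ⟨c, hc, if_neg fun h => hmk (hQ.1 h).2⟩ }
  have hU : ∀ {c : ℕ × ℕ}, c ∈ U.innerShape k ↔ c ∈ Q.shape := by
    rintro ⟨i, j⟩
    rw [SYT.mem_innerShape]
    constructor
    · rintro ⟨h1, h2⟩
      by_contra h3
      have h4 : U.entry i j = T.1.entry i j := if_neg h3
      have h5 := hin h1 h3
      simp only at h2 h5
      omega
    · intro h
      have h4 : U.entry i j = Q.entry i j := if_pos h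
      exact ⟨(hQ.1 h).1, h4.le.trans (Q.entry_le h)⟩
  ⟨U, by
    apply SYT.ext
    · ext c
      exact hU
    · funext i j
      change (if (i, j) ∈ U.innerShape k then U.entry i j else 0) = Q.entry i j
      by_cases h : (i, j) ∈ Q.shape
      · rw [if_pos (hU.2 h)]
        exact if_pos h
      · rw [if_neg (fun h' => h (hU.1 h'))]
        exact (Q.zeros h).symm⟩

end TableauOrder

/-! # Inner tableau translation preserves coverings in the weak order for hooks -/

namespace TableauOrder

/-! ### Row insertion on families of rows -/

/-! The translation $\mathcal V_{[Q,R]}$ is inverse to $\mathcal V_{[R,Q]}$, so once translation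
between hooks is monotone it is an isomorphism of preorders (`innerTranslateIso`) and preserves
coverings. Monotonicity is proved on words. Apart from $S=T$, a relation $S\le T$ is a chain of
words whose steps either swap an adjacent ascent or keep the insertion tableau
(`reflTransGen_of_le`, `le_of_reflTransGen`). Call the letters $1,\dots,k$ small and the others
large.

Convexity. Deleting the large letters turns such a chain into another one. Along it, the number of
first-row entries $\le m$ cannot grow, since it is the maximal length of a weakly increasing
subsequence with letters $\le m$; and a strictly decreasing subsequence of a given length, once
present, persists. If both ends have the same hook tableau, then the first row is constant, there
are enough rows to force a hook, and the column consists of the remaining letters in order. Hence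
the small letters have tableau $R$ throughout the chain (`insW_eq_of_between`,
`reflTransGen_constant`).

Translating a word. Replace its small letters so that the small insertion tableau grows through the
same shapes and ends at $Q$; for hooks this is an explicit reverse insertion
(`exists_sameEvolution`). The large part of the insertion tableau depends only on the large letters,
their places and the growth of the small shape (`insW_glue`), so the new word lies in the Knuth
class of the translated tableau.

Translating a step. A step that keeps the tableau translates to another such step, and a swap with a
large letter translates to a swap. If a swap of two small letters keeps the small hook tableau, then
a neighbouring small letter makes it an elementary Knuth relation on the small word
(`exists_witness`), because in a hook the first row grows exactly at ascents
(`HookRows.length_ascent`). In the translated triple this relation may become the one of the other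
type, whose two letters are separated by large letters in the full word. In that case the two words
are still Knuth equivalent, or joined by one ascent swap up to Knuth equivalence
(`knuthSwap_suffix`, `knuthSwap_prefix`). -/

theorem mem_rowInsert {x y : ℕ} {r : List ℕ} (h : y ∈ (rowInsert x r).1) : y = x ∨ y ∈ r := by
  induction r with
  | nil => simpa [rowInsert] using h
  | cons e r ih =>
    unfold rowInsert at h
    split_ifs at h <;> grind

theorem rowInsert_snd_mem {x y : ℕ} {r : List ℕ} (h : (rowInsert x r).2 = some y) :
    y ∈ r ∧ x < y := by
  induction r with
  | nil => simp [rowInsert] at h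
  | cons e r ih =>
    unfold rowInsert at h
    split_ifs at h <;> grind

theorem mem_rowInsert_self (x : ℕ) (r : List ℕ) : x ∈ (rowInsert x r).1 := by
  induction r with
  | nil => simp [rowInsert]
  | cons e r ih =>
    unfold rowInsert
    split_ifs <;> grind

theorem rowInsert_sorted {x : ℕ} {r : List ℕ} (h : r.Pairwise (· ≤ ·)) :
    (rowInsert x r).1.Pairwise (· ≤ ·) := by
  induction r with
  | nil => simp [rowInsert]
  | cons e r ih =>
    rw [List.pairwise_cons] at h
    unfold rowInsert
    split_ifs with hx
    · exact List.pairwise_cons.2 ⟨fun y hy => hx.le.trans (h.1 y hy), h.2⟩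
    · refine List.pairwise_cons.2 ⟨fun y hy => ?_, ih h.2⟩
      rcases mem_rowInsert hy with rfl | hy
      · omega
      · exact h.1 y hy

/-- Inserting a word into a single row: the new row and the word of bumped letters. -/
def rowInsertWord : List ℕ → List ℕ → List ℕ × List ℕ
  | [], r => (r, [])
  | x :: l, r =>
    ((rowInsertWord l (rowInsert x r).1).1,
      (rowInsert x r).2.toList ++ (rowInsertWord l (rowInsert x r).1).2)

/-- Insertion of a letter into a family of rows. -/
def insF : ℕ → (ℕ → List ℕ) → ℕ → List ℕ
  | x, f, 0 => (rowInsert x (f 0)).1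
  | x, f, i + 1 =>
    match (rowInsert x (f 0)).2 with
    | none => f (i + 1)
    | some b => insF b (fun j => f (j + 1)) i

/-- Insertion of a word into a family of rows. -/
def insL (l : List ℕ) (f : ℕ → List ℕ) : ℕ → List ℕ :=
  l.foldl (fun g x => insF x g) f

/-- The family of rows of the insertion tableau of a word. -/
def insW (w : List ℕ) : ℕ → List ℕ := insL w fun _ => []

theorem insL_append (l l' : List ℕ) (f : ℕ → List ℕ) : insL (l ++ l') f = insL l' (insL l f) :=
  List.foldl_append ..

theorem insW_append (l l' : List ℕ) : insW (l ++ l') = insL l' (insW l) := insL_append ..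

theorem insW_concat (l : List ℕ) (x : ℕ) : insW (l ++ [x]) = insF x (insW l) := insW_append ..

theorem insL_zero (l : List ℕ) (f : ℕ → List ℕ) : insL l f 0 = (rowInsertWord l (f 0)).1 := by
  induction l generalizing f with
  | nil => rfl
  | cons x l ih => exact ih (insF x f)

/-- The lower rows only see the word of letters bumped out of the first row. This permits induction
on the row index with the inserted word varying. -/
theorem insL_succ (l : List ℕ) (f : ℕ → List ℕ) (i : ℕ) :
    insL l f (i + 1) = insL (rowInsertWord l (f 0)).2 (fun j => f (j + 1)) i := by
  induction l generalizing f with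
  | nil => rfl
  | cons x l ih =>
    refine (ih (insF x f)).trans ?_
    rw [rowInsertWord, insL_append]
    have h : (fun j => insF x f (j + 1))
        = insL (rowInsert x (f 0)).2.toList (fun j => f (j + 1)) := by
      funext j
      rw [insF]
      cases (rowInsert x (f 0)).2 <;> rfl
    rw [h]
    rfl

theorem insF_sorted {x : ℕ} {f : ℕ → List ℕ} (h : ∀ i, (f i).Pairwise (· ≤ ·)) (i : ℕ) :
    (insF x f i).Pairwise (· ≤ ·) := by
  induction i generalizing x f with
  | zero => exact rowInsert_sorted (h 0)
  | succ i ih =>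
    rw [insF]
    cases (rowInsert x (f 0)).2 with
    | none => exact h _
    | some b => exact ih fun j => h (j + 1)

theorem insL_sorted {l : List ℕ} {f : ℕ → List ℕ} (h : ∀ i, (f i).Pairwise (· ≤ ·)) (i : ℕ) :
    (insL l f i).Pairwise (· ≤ ·) := by
  induction l generalizing f with
  | nil => exact h i
  | cons x l ih => exact ih (insF_sorted h)

theorem insW_sorted (w : List ℕ) (i : ℕ) : (insW w i).Pairwise (· ≤ ·) :=
  insL_sorted (fun _ => List.Pairwise.nil) i

/-! ### Knuth relations -/

/-- The elementary Knuth relations. -/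
inductive KnuthTriple : List ℕ → List ℕ → Prop
  | bac {a b c : ℕ} : a < b → b ≤ c → KnuthTriple [b, a, c] [b, c, a]
  | acb {a b c : ℕ} : a ≤ b → b < c → KnuthTriple [a, c, b] [c, a, b]

theorem rowInsert_two_le {b c c' : ℕ} {r : List ℕ} (hbc : b ≤ c) (hr : r.Pairwise (· ≤ ·))
    (h : (rowInsert c (rowInsert b r).1).2 = some c') :
    ∃ b', (rowInsert b r).2 = some b' ∧ b < b' ∧ b' ≤ c' := by
  induction r with
  | nil => simp [rowInsert, hbc.not_gt] at h
  | cons e r ih =>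
    rw [List.pairwise_cons] at hr
    by_cases hb : b < e
    · simp only [rowInsert, if_pos hb, if_neg hbc.not_gt] at h ⊢
      exact ⟨e, rfl, hb, hr.1 _ (rowInsert_snd_mem h).1⟩
    · simp only [rowInsert, if_neg hb, if_neg (show ¬ c < e by omega)] at h ⊢
      exact ih hr.2 h

/-- Once `c` is in the row, it is an entry greater than `b`, so `b` must bump, and what it bumps is
at most `c`. -/
theorem rowInsert_two_gt {b c : ℕ} {r : List ℕ} (hbc : b < c) :
    ∃ b', (rowInsert b (rowInsert c r).1).2 = some b' ∧ b < b' ∧ b' ≤ c := by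
  induction r with
  | nil => simp [rowInsert, hbc]
  | cons e r ih =>
    by_cases hc : c < e
    · simp [rowInsert, if_pos hc, hbc]
    · by_cases hb : b < e
      · simp only [rowInsert, if_neg hc, if_pos hb]
        exact ⟨e, rfl, hb, by omega⟩
      · simp only [rowInsert, if_neg hc, if_neg hb]
        exact ih

/-- A Knuth relation passes through one row: the row does not notice it, and the bumped words are
again equal or Knuth related. This is the inductive step for invariance of the whole tableau. -/
theorem rowInsertWord_bac {a b c : ℕ} (hab : a < b) (hbc : b ≤ c) {r : List ℕ}
    (hr : r.Pairwise (· ≤ ·)) :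
    (rowInsertWord [b, a, c] r).1 = (rowInsertWord [b, c, a] r).1 ∧
    ((rowInsertWord [b, a, c] r).2 = (rowInsertWord [b, c, a] r).2 ∨
      KnuthTriple (rowInsertWord [b, a, c] r).2 (rowInsertWord [b, c, a] r).2) := by
  have hac : a < c := hab.trans_le hbc
  induction r with
  | nil => simp [rowInsertWord, rowInsert, hab, hbc.not_gt, hac.not_gt]
  | cons e r ih =>
    rw [List.pairwise_cons] at hr
    by_cases hb : b < e
    · simp only [rowInsertWord, rowInsert, if_pos hb, if_pos hab, if_neg hbc.not_gt,
        if_neg hac.not_gt, true_and]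
      rcases h : (rowInsert c r).2 with _ | c'
      · simp
      · have h1 := rowInsert_snd_mem h
        exact Or.inr (KnuthTriple.bac hb (hr.1 _ h1.1))
    · by_cases ha : a < e
      · simp only [rowInsertWord, rowInsert, if_neg hb, if_pos ha, if_neg (show ¬ c < e by omega),
          if_neg hac.not_gt, true_and]
        rcases h : (rowInsert c (rowInsert b r).1).2 with _ | c'
        · simp
        · obtain ⟨b', h1, h2, h3⟩ := rowInsert_two_le hbc hr.2 h
          simp only [h1]
          exact Or.inr (KnuthTriple.bac (by omega) h3)
      · have := ih hr.2
        simp only [rowInsertWord, rowInsert, if_neg hb, if_neg ha, if_neg (show ¬ c < e by omega)]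
          at this ⊢
        exact ⟨by rw [this.1], this.2⟩

theorem rowInsertWord_acb {a b c : ℕ} (hab : a ≤ b) (hbc : b < c) {r : List ℕ}
    (hr : r.Pairwise (· ≤ ·)) :
    (rowInsertWord [a, c, b] r).1 = (rowInsertWord [c, a, b] r).1 ∧
    ((rowInsertWord [a, c, b] r).2 = (rowInsertWord [c, a, b] r).2 ∨
      KnuthTriple (rowInsertWord [a, c, b] r).2 (rowInsertWord [c, a, b] r).2 ∨
      KnuthTriple (rowInsertWord [c, a, b] r).2 (rowInsertWord [a, c, b] r).2) := by
  have hac : a < c := hab.trans_lt hbc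
  induction r with
  | nil => simp [rowInsertWord, rowInsert, hac, hbc, hab.not_gt, hac.not_gt]
  | cons e r ih =>
    rw [List.pairwise_cons] at hr
    by_cases hc : c < e
    · have ha : a < e := by omega
      cases r with
      | nil =>
        simp [rowInsertWord, rowInsert, if_pos hc, if_pos ha, if_pos hac, if_neg hac.not_gt,
          if_neg hab.not_gt, if_pos hbc]
      | cons e' r =>
        have he := hr.1 e' (by simp)
        simp only [rowInsertWord, rowInsert, if_pos hc, if_pos ha, if_pos hac, if_neg hac.not_gt,
          if_neg hab.not_gt, if_pos hbc, if_pos (show c < e' by omega),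
          if_pos (show b < e' by omega), true_and]
        -- Here the bumped words are `e e' c` and `e c e'`: the relation changes its type and its
        -- direction.
        exact Or.inr (Or.inr (KnuthTriple.bac hc he))
    · by_cases ha : a < e
      · simp only [rowInsertWord, rowInsert, if_neg hc, if_pos ha, if_neg hac.not_gt,
          if_neg hab.not_gt, true_and]
        obtain ⟨b', h1, h2, h3⟩ := rowInsert_two_gt (r := r) hbc
        rcases h : (rowInsert c r).2 with _ | c'
        · simp
        · have h4 := rowInsert_snd_mem h
          simp only [h1]
          refine Or.inr (Or.inl (KnuthTriple.acb ?_ (by omega)))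
          rcases mem_rowInsert (rowInsert_snd_mem h1).1 with h5 | h5
          · omega
          · exact hr.1 _ h5
      · have := ih hr.2
        simp only [rowInsertWord, rowInsert, if_neg hc, if_neg ha, if_neg (show ¬ b < e by omega)]
          at this ⊢
        exact ⟨by rw [this.1], this.2⟩

theorem insL_knuthTriple {l l' : List ℕ} (h : KnuthTriple l l') {f : ℕ → List ℕ}
    (hf : ∀ i, (f i).Pairwise (· ≤ ·)) : insL l f = insL l' f := by
  funext i
  induction i generalizing l l' f with
  | zero =>
    rw [insL_zero, insL_zero]
    cases h with
    | bac h1 h2 => exact (rowInsertWord_bac h1 h2 (hf 0)).1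
    | acb h1 h2 => exact (rowInsertWord_acb h1 h2 (hf 0)).1
  | succ i ih =>
    rw [insL_succ, insL_succ]
    have hf' : ∀ j, (f (j + 1)).Pairwise (· ≤ ·) := fun j => hf _
    cases h with
    | bac h1 h2 =>
      rcases (rowInsertWord_bac h1 h2 (hf 0)).2 with h | h
      · rw [h]
      · exact ih h hf'
    | acb h1 h2 =>
      rcases (rowInsertWord_acb h1 h2 (hf 0)).2 with h | h | h
      · rw [h]
      · exact ih h hf'
      · exact (ih h hf').symm

/-- Knuth equivalence of words. -/
inductive KnuthEquiv : List ℕ → List ℕ → Prop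
  | refl (w : List ℕ) : KnuthEquiv w w
  | symm {w w' : List ℕ} : KnuthEquiv w w' → KnuthEquiv w' w
  | trans {w w' w'' : List ℕ} : KnuthEquiv w w' → KnuthEquiv w' w'' → KnuthEquiv w w''
  | triple {l l' : List ℕ} (P Y : List ℕ) : KnuthTriple l l' → KnuthEquiv (P ++ l ++ Y) (P ++ l' ++ Y)

theorem KnuthEquiv.congr {w w' : List ℕ} (h : KnuthEquiv w w') (P Y : List ℕ) :
    KnuthEquiv (P ++ w ++ Y) (P ++ w' ++ Y) := by
  induction h with
  | refl => exact .refl _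
  | symm _ ih => exact ih.symm
  | trans _ _ ih1 ih2 => exact ih1.trans ih2
  | triple P' Y' h => simpa using KnuthEquiv.triple (P ++ P') (Y' ++ Y) h

theorem KnuthEquiv.append {u u' v v' : List ℕ} (h : KnuthEquiv u u') (h' : KnuthEquiv v v') :
    KnuthEquiv (u ++ v) (u' ++ v') := by
  have h1 := h.congr [] v
  have h2 := h'.congr u' []
  simp only [List.nil_append, List.append_nil] at h1 h2
  exact h1.trans h2

theorem KnuthEquiv.cons (x : ℕ) {v v' : List ℕ} (h : KnuthEquiv v v') :
    KnuthEquiv (x :: v) (x :: v') := KnuthEquiv.append (.refl [x]) h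

theorem KnuthEquiv.perm {w w' : List ℕ} (h : KnuthEquiv w w') : w.Perm w' := by
  induction h with
  | refl => exact .refl _
  | symm _ ih => exact ih.symm
  | trans _ _ ih1 ih2 => exact ih1.trans ih2
  | triple P Y h =>
    refine ((List.Perm.refl P).append ?_).append (.refl Y)
    cases h with
    | bac => exact (List.Perm.swap ..).cons _
    | acb => exact List.Perm.swap ..

theorem KnuthEquiv.insW_eq {w w' : List ℕ} (h : KnuthEquiv w w') : insW w = insW w' := by
  induction h with
  | refl => rfl
  | symm _ ih => exact ih.symm
  | trans _ _ ih1 ih2 => exact ih1.trans ih2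
  | triple P Y h =>
    rw [insW_append, insW_append, insW_append, insW_append, insL_knuthTriple h (insW_sorted P)]

/-- `b a c ~ b c a`, with a suffix. -/
theorem KnuthEquiv.bac {a b c : ℕ} (h1 : a < b) (h2 : b ≤ c) (Y : List ℕ) :
    KnuthEquiv (b :: a :: c :: Y) (b :: c :: a :: Y) := .triple [] Y (.bac h1 h2)

/-- `a c b ~ c a b`, with a suffix. -/
theorem KnuthEquiv.acb {a b c : ℕ} (h1 : a ≤ b) (h2 : b < c) (Y : List ℕ) :
    KnuthEquiv (a :: c :: b :: Y) (c :: a :: b :: Y) := .triple [] Y (.acb h1 h2)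

/-! ### Small and large letters -/

/-- Row-wise concatenation of two families of rows. -/
def glue (s B : ℕ → List ℕ) (i : ℕ) : List ℕ := s i ++ B i

/-- The effect on the large letters of adding a cell to the small tableau in the first row `i`
with `g i = true`. -/
def slide : (ℕ → Bool) → (ℕ → List ℕ) → ℕ → List ℕ
  | g, B, 0 => bif g 0 then (B 0).tail else B 0
  | g, B, i + 1 =>
    bif g 0 then
      match (B 0).head? with
      | none => B (i + 1)
      | some y => insF y (fun j => B (j + 1)) i
    else slide (fun j => g (j + 1)) (fun j => B (j + 1)) i

/-- The rows that become longer when `x` is inserted into `s`. -/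
def growth (x : ℕ) (s : ℕ → List ℕ) (i : ℕ) : Bool :=
  decide ((insF x s i).length ≠ (s i).length)

theorem length_rowInsert (x : ℕ) (r : List ℕ) :
    (rowInsert x r).1.length = r.length + if (rowInsert x r).2 = none then 1 else 0 := by
  induction r with
  | nil => rfl
  | cons e r ih =>
    unfold rowInsert
    split_ifs <;> simp_all

theorem rowInsert_append_of_le {x : ℕ} {s : List ℕ} (B : List ℕ) (h : ∀ y ∈ s, y ≤ x) :
    rowInsert x (s ++ B) = (s ++ (rowInsert x B).1, (rowInsert x B).2) := by
  induction s with
  | nil => rfl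
  | cons e s ih =>
    have h1 := h e (by simp)
    rw [List.cons_append, rowInsert, if_neg h1.not_gt, ih fun y hy => h y (by simp [hy])]
    rfl

theorem rowInsert_append_some {x b : ℕ} {s : List ℕ} (B : List ℕ) (h : (rowInsert x s).2 = some b) :
    rowInsert x (s ++ B) = ((rowInsert x s).1 ++ B, some b) := by
  induction s with
  | nil => simp [rowInsert] at h
  | cons e s ih =>
    rw [List.cons_append]
    by_cases hx : x < e
    · simp only [rowInsert, if_pos hx] at h ⊢
      rw [h]
      rfl
    · simp only [rowInsert, if_neg hx] at h ⊢
      rw [ih h]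
      rfl

theorem rowInsert_append_none {x : ℕ} {s B : List ℕ} (h : (rowInsert x s).2 = none)
    (hB : ∀ y ∈ B, x < y) :
    rowInsert x (s ++ B) = ((rowInsert x s).1 ++ B.tail, B.head?) := by
  induction s with
  | nil =>
    cases B with
    | nil => rfl
    | cons y B => simp [rowInsert, hB y (by simp)]
  | cons e s ih =>
    rw [List.cons_append]
    by_cases hx : x < e
    · simp [rowInsert, if_pos hx] at h
    · simp only [rowInsert, if_neg hx] at h ⊢
      rw [ih h]
      rfl

/-- A large letter never bumps a small one, so the small tableau is inert. -/
theorem insF_glue_large {x k : ℕ} {s B : ℕ → List ℕ} (hx : k < x) (hs : ∀ i, ∀ y ∈ s i, y ≤ k) :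
    insF x (glue s B) = glue s (insF x B) := by
  funext i
  induction i generalizing x s B with
  | zero =>
    change (rowInsert x (s 0 ++ B 0)).1 = s 0 ++ (rowInsert x (B 0)).1
    rw [rowInsert_append_of_le _ fun y hy => (hs 0 y hy).trans hx.le]
  | succ i ih =>
    change insF x (glue s B) (i + 1) = s (i + 1) ++ insF x B (i + 1)
    rw [insF, insF, show glue s B 0 = s 0 ++ B 0 from rfl,
      rowInsert_append_of_le _ fun y hy => (hs 0 y hy).trans hx.le]
    rcases h : (rowInsert x (B 0)).2 with _ | b
    · rfl
    · exact ih (hx.trans (rowInsert_snd_mem h).2) fun j => hs (j + 1)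

/-- As long as small letters bump small letters, the large ones stay in place. In the row where the
small tableau gains a cell, the first large entry is displaced and inserted below. Thus the large
part depends on `x` and `s` only through the row that grows. -/
theorem insF_glue_small {x k : ℕ} {s B : ℕ → List ℕ} (hx : x ≤ k) (hs : ∀ i, ∀ y ∈ s i, y ≤ k)
    (hB : ∀ i, ∀ y ∈ B i, k < y) :
    insF x (glue s B) = glue (insF x s) (slide (growth x s) B) := by
  funext i
  have hg : ∀ {x : ℕ} {s : ℕ → List ℕ}, growth x s 0 = decide ((rowInsert x (s 0)).2 = none) := by
    intro x s
    unfold growth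
    rw [insF, length_rowInsert]
    split_ifs with h <;> simp [h]
  induction i generalizing x s B with
  | zero =>
    change (rowInsert x (s 0 ++ B 0)).1 = (rowInsert x (s 0)).1 ++ slide (growth x s) B 0
    rw [slide, hg]
    rcases h : (rowInsert x (s 0)).2 with _ | b
    · rw [rowInsert_append_none h fun y hy => hx.trans_lt (hB 0 y hy)]
      rfl
    · rw [rowInsert_append_some _ h]
      rfl
  | succ i ih =>
    change insF x (glue s B) (i + 1) = insF x s (i + 1) ++ slide (growth x s) B (i + 1)
    rw [insF, insF, slide, show glue s B 0 = s 0 ++ B 0 from rfl, hg]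
    rcases h : (rowInsert x (s 0)).2 with _ | b
    · rw [rowInsert_append_none h fun y hy => hx.trans_lt (hB 0 y hy)]
      simp only [decide_true, cond_true]
      rcases h' : (B 0).head? with _ | y
      · rfl
      · have hy : k < y := hB 0 y (List.mem_of_mem_head? h')
        exact congrFun (insF_glue_large (B := fun j => B (j + 1)) hy fun j => hs (j + 1)) i
    · rw [rowInsert_append_some _ h]
      have hb : b ≤ k := hs 0 b (rowInsert_snd_mem h).1
      refine (ih hb (fun j => hs (j + 1)) fun j => hB (j + 1)).trans ?_
      have hgs : growth b (fun j => s (j + 1)) = fun j => growth x s (j + 1) := by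
        funext j
        unfold growth
        rw [insF, h]
      rw [hgs]
      rfl

theorem mem_insF {x y : ℕ} {f : ℕ → List ℕ} {i : ℕ} (h : y ∈ insF x f i) :
    y = x ∨ ∃ j, y ∈ f j := by
  induction i generalizing x f with
  | zero => exact (mem_rowInsert h).imp_right fun h => ⟨0, h⟩
  | succ i ih =>
    rw [insF] at h
    rcases h' : (rowInsert x (f 0)).2 with _ | b
    · rw [h'] at h
      exact Or.inr ⟨_, h⟩
    · rw [h'] at h
      rcases ih h with rfl | ⟨j, h⟩
      · exact Or.inr ⟨0, (rowInsert_snd_mem h').1⟩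
      · exact Or.inr ⟨j + 1, h⟩

theorem mem_insW {y : ℕ} {w : List ℕ} {i : ℕ} (h : y ∈ insW w i) : y ∈ w := by
  induction w using List.reverseRecOn generalizing i with
  | nil => exact h
  | append_singleton w x ih =>
    rw [insW_concat] at h
    rcases mem_insF h with rfl | ⟨j, h⟩
    · simp
    · exact List.mem_append_left _ (ih h)

theorem mem_slide {y : ℕ} {g : ℕ → Bool} {B : ℕ → List ℕ} {i : ℕ} (h : y ∈ slide g B i) :
    ∃ j, y ∈ B j := by
  induction i generalizing g B with
  | zero =>
    rw [slide] at h
    cases hg : g 0 <;> rw [hg] at h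
    · exact ⟨0, h⟩
    · exact ⟨0, List.mem_of_mem_tail h⟩
  | succ i ih =>
    rw [slide] at h
    cases hg : g 0 <;> rw [hg] at h
    · exact (ih h).imp' (· + 1) fun _ h => h
    · rcases h' : (B 0).head? with _ | b
      · rw [h'] at h
        exact ⟨_, h⟩
      · rw [h'] at h
        rcases mem_insF h with rfl | ⟨j, h⟩
        · exact ⟨0, List.mem_of_mem_head? h'⟩
        · exact ⟨j + 1, h⟩

/-- The subword of the letters `1, …, k`. -/
def small (k : ℕ) (w : List ℕ) : List ℕ := w.filter (· ≤ k)

theorem small_append (k : ℕ) (w w' : List ℕ) : small k (w ++ w') = small k w ++ small k w' :=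
  List.filter_append ..

theorem mem_small {k y : ℕ} {w : List ℕ} : y ∈ small k w ↔ y ∈ w ∧ y ≤ k := by simp [small]

theorem small_cons_of_le {k x : ℕ} (h : x ≤ k) (w : List ℕ) : small k (x :: w) = x :: small k w := by
  simp [small, h]

theorem small_cons_of_lt {k x : ℕ} (h : k < x) (w : List ℕ) : small k (x :: w) = small k w := by
  simp [small, h]

theorem small_eq_nil {k : ℕ} {w : List ℕ} (h : ∀ y ∈ w, k < y) : small k w = [] := by
  simpa [small] using h

/-! ### Growth of shapes and simultaneous insertion of small and large letters -/

/-- Two words whose insertion tableaux have the same shape at every stage. -/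
def SameEvolution (u u' : List ℕ) : Prop :=
  u.length = u'.length ∧
    ∀ m i, (insW (u.take m) i).length = (insW (u'.take m) i).length

theorem SameEvolution.refl (u : List ℕ) : SameEvolution u u := ⟨rfl, fun _ _ => rfl⟩

theorem SameEvolution.of_append {p y p' y' : List ℕ} (h : SameEvolution (p ++ y) (p' ++ y'))
    (hl : p.length = p'.length) : SameEvolution p p' := by
  refine ⟨hl, fun m i => ?_⟩
  -- Truncating at `min m p.length` keeps the prefix inside `p`, and it is the same prefix of `p` as
  -- at `m`.
  have h1 := h.2 (min m p.length) i
  rw [List.take_append_of_le_length (min_le_right ..),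
    List.take_append_of_le_length (hl ▸ min_le_right ..)] at h1
  have h2 : ∀ q : List ℕ, q.take (min m q.length) = q.take m := by
    intro q
    rcases le_total m q.length with h | h
    · rw [min_eq_left h]
    · rw [min_eq_right h, List.take_length, List.take_of_length_le h]
  rwa [h2, hl, h2] at h1

theorem SameEvolution.length_eq {u u' : List ℕ} (h : SameEvolution u u') (i : ℕ) :
    (insW u i).length = (insW u' i).length := by
  have := h.2 u.length i
  rwa [List.take_length, h.1, List.take_length] at this

theorem SameEvolution.concat {u u' : List ℕ} {x x' : ℕ} (h : SameEvolution u u')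
    (h' : ∀ i, (insW (u ++ [x]) i).length = (insW (u' ++ [x']) i).length) :
    SameEvolution (u ++ [x]) (u' ++ [x']) := by
  have hl := h.1
  refine ⟨by simp [hl], fun m i => ?_⟩
  rcases Nat.lt_or_ge u.length m with hm | hm
  · rw [List.take_of_length_le (by simp; omega), List.take_of_length_le (by simp; omega)]
    exact h' i
  · rw [List.take_append_of_le_length hm, List.take_append_of_le_length (hl ▸ hm)]
    exact h.2 m i

/-- The words `w` and `w'` have the same large letters, at the same places. -/
def SameLarge (k : ℕ) : List ℕ → List ℕ → Prop :=
  List.Forall₂ fun x x' => x ≤ k ∧ x' ≤ k ∨ k < x ∧ x = x'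

theorem SameLarge.small_length {k : ℕ} {w w' : List ℕ} (h : SameLarge k w w') :
    (small k w).length = (small k w').length := by
  induction h with
  | nil => rfl
  | cons h _ ih =>
    rcases h with ⟨h1, h2⟩ | ⟨h1, rfl⟩
    · simp [small_cons_of_le, h1, h2, ih]
    · simp [small_cons_of_lt, h1, ih]

theorem SameLarge.of_append {k : ℕ} {p y w : List ℕ} (h : SameLarge k (p ++ y) w) :
    ∃ p' y', SameLarge k p p' ∧ SameLarge k y y' ∧ w = p' ++ y' := by
  induction p generalizing w with
  | nil => exact ⟨[], w, .nil, h, rfl⟩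
  | cons x p ih =>
    cases h with
    | cons h1 h2 =>
      obtain ⟨p', y', h3, h4, rfl⟩ := ih h2
      exact ⟨_ :: p', y', .cons h1 h3, h4, rfl⟩

/-- The same family `B` serves both words: insertion of a large letter acts on `B` alone, and
insertion of a small letter acts on `B` through the growing row, which equal evolution makes the
same for both. -/
theorem insW_glue {k : ℕ} {w w' : List ℕ} (h : SameLarge k w w')
    (he : SameEvolution (small k w) (small k w')) :
    ∃ B : ℕ → List ℕ, (∀ i, ∀ y ∈ B i, k < y) ∧ insW w = glue (insW (small k w)) B ∧
      insW w' = glue (insW (small k w')) B := by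
  induction w using List.reverseRecOn generalizing w' with
  | nil =>
    cases h
    exact ⟨fun _ => [], by simp, by funext i; rfl, by funext i; rfl⟩
  | append_singleton w x ih =>
    obtain ⟨v, v', h1, h2, rfl⟩ := h.of_append
    obtain ⟨x', hx, rfl⟩ : ∃ x', (x ≤ k ∧ x' ≤ k ∨ k < x ∧ x = x') ∧ v' = [x'] := by
      cases h2 with
      | cons h2 h3 =>
        cases h3
        exact ⟨_, h2, rfl⟩
    have hs : ∀ (u : List ℕ) (i : ℕ), ∀ y ∈ insW (small k u) i, y ≤ k :=
      fun u i y hy => (mem_small.1 (mem_insW hy)).2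
    rw [small_append, small_append] at he
    obtain ⟨B, hB, h3, h4⟩ := ih h1 (he.of_append h1.small_length)
    rw [small_append, small_append, insW_concat, insW_concat, h3, h4]
    rcases hx with ⟨hx, hx'⟩ | ⟨hx, rfl⟩
    · refine ⟨slide (growth x (insW (small k w))) B, fun i y hy => ?_, ?_, ?_⟩
      · obtain ⟨j, hj⟩ := mem_slide hy
        exact hB j y hj
      · rw [insF_glue_small hx (hs w) hB, small_cons_of_le hx, insW_append]
        rfl
      · rw [insF_glue_small hx' (hs v) hB, small_cons_of_le hx', insW_append]
        have hg : growth x (insW (small k w)) = growth x' (insW (small k v)) := by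
          funext i
          have e1 := (he.of_append h1.small_length).length_eq i
          have e2 := he.length_eq i
          rw [small_cons_of_le hx, small_cons_of_le hx'] at e2
          change (insW (small k w ++ [x]) i).length = (insW (small k v ++ [x']) i).length at e2
          rw [insW_concat, insW_concat] at e2
          unfold growth
          rw [e1, e2]
        rw [hg]
        rfl
    · refine ⟨insF x B, fun i y hy => ?_, ?_, ?_⟩
      · rcases mem_insF hy with rfl | ⟨j, hj⟩
        · exact hx
        · exact hB j y hj
      · rw [insF_glue_large hx (hs w), small_cons_of_lt hx]
        simp [small]
      · rw [insF_glue_large hx (hs v), small_cons_of_lt hx]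
        simp [small]

/-- The small letters of the insertion tableau form the insertion tableau of the small letters. -/
theorem filter_insW (k : ℕ) (w : List ℕ) (i : ℕ) : small k (insW w i) = insW (small k w) i := by
  have h : SameLarge k w w := List.forall₂_same.2 fun x _ => by omega
  obtain ⟨B, hB, h1, -⟩ := insW_glue h (.refl _)
  rw [h1]
  change small k (insW (small k w) i ++ B i) = _
  rw [small_append, small_eq_nil (hB i), List.append_nil]
  exact List.filter_eq_self.2 fun y hy => by simpa using (mem_small.1 (mem_insW hy)).2

/-! ### Columns -/

/-- `q` can be placed below `r`: it is not longer, and columns increase strictly. -/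
def Below : List ℕ → List ℕ → Prop
  | _, [] => True
  | [], _ :: _ => False
  | a :: r, b :: q => a < b ∧ Below r q

theorem Below.rowInsert_left {r q : List ℕ} (h : Below r q) (x : ℕ) : Below (rowInsert x r).1 q := by
  induction r generalizing q with
  | nil =>
    cases q with
    | nil => simp [Below]
    | cons b q => exact h.elim
  | cons a r ih =>
    cases q with
    | nil => simp [Below]
    | cons b q =>
      unfold rowInsert
      split_ifs with hx
      · exact ⟨hx.trans h.1, h.2⟩
      · exact ⟨h.1, ih h.2⟩

/-- The entry below the bumped `y` exceeds `y`, so `y` enters the next row weakly to the left of its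
old column; this keeps columns strict. -/
theorem Below.rowInsert {r q : List ℕ} (h : Below r q) {x y : ℕ} (hy : (rowInsert x r).2 = some y) :
    Below (rowInsert x r).1 (TableauOrder.rowInsert y q).1 := by
  induction r generalizing q with
  | nil => simp [TableauOrder.rowInsert] at hy
  | cons a r ih =>
    unfold TableauOrder.rowInsert at hy
    split_ifs at hy with hx
    · obtain rfl : a = y := by simpa using hy
      cases q with
      | nil => simp [TableauOrder.rowInsert, hx, Below]
      | cons b q => simpa [TableauOrder.rowInsert, hx, h.1, Below] using h.2
    · have hy' := rowInsert_snd_mem hy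
      have e : TableauOrder.rowInsert x (a :: r)
          = (a :: (TableauOrder.rowInsert x r).1, (TableauOrder.rowInsert x r).2) := by
        rw [TableauOrder.rowInsert, if_neg hx]
      rw [e]
      cases q with
      | nil => exact ⟨by omega, by simp [Below]⟩
      | cons b q =>
        rw [TableauOrder.rowInsert]
        split_ifs with hb
        · exact ⟨by omega, h.2.rowInsert_left x⟩
        · exact ⟨h.1, ih h.2 hy⟩

theorem below_insF {f : ℕ → List ℕ} (h : ∀ i, Below (f i) (f (i + 1))) (x i : ℕ) :
    Below (insF x f i) (insF x f (i + 1)) := by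
  induction i generalizing x f with
  | zero =>
    rw [insF, insF]
    rcases hx : (rowInsert x (f 0)).2 with _ | y
    · exact (h 0).rowInsert_left x
    · exact (h 0).rowInsert hx
  | succ i ih =>
    rw [insF, insF.eq_2 x f (i + 1)]
    rcases hx : (rowInsert x (f 0)).2 with _ | y
    · exact h _
    · exact ih (f := fun j => f (j + 1)) (fun j => h (j + 1)) y

theorem below_insW (w : List ℕ) (i : ℕ) : Below (insW w i) (insW w (i + 1)) := by
  induction w using List.reverseRecOn generalizing i with
  | nil => simp [insW, insL, Below]
  | append_singleton w x ih =>
    rw [insW_concat]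
    exact below_insF ih x i

theorem Below.length_le {r q : List ℕ} (h : Below r q) : q.length ≤ r.length := by
  induction r generalizing q with
  | nil =>
    cases q with
    | nil => rfl
    | cons => exact h.elim
  | cons a r ih =>
    cases q with
    | nil => simp
    | cons b q => simpa using ih h.2

theorem Below.getElem_lt {r q : List ℕ} (h : Below r q) {j : ℕ} (hj : j < q.length) :
    r[j]'(hj.trans_le h.length_le) < q[j] := by
  induction r generalizing q j with
  | nil =>
    cases q with
    | nil => simp at hj
    | cons => exact h.elim
  | cons a r ih =>
    cases q with
    | nil => simp at hj
    | cons b q =>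
      cases j with
      | zero => exact h.1
      | succ j => exact ih h.2 (by simpa using hj)

/-! ### Lists of rows -/

/-- The family of rows of a list of rows. -/
def row (t : List (List ℕ)) (i : ℕ) : List ℕ := t.getD i []

/-- The insertion tableau of a word, as a list of rows. -/
def tabW (w : List ℕ) : List (List ℕ) := w.foldl (fun t x => tabInsert x t) []

theorem tabW_concat (w : List ℕ) (x : ℕ) : tabW (w ++ [x]) = tabInsert x (tabW w) :=
  List.foldl_append ..

theorem row_tabInsert (x : ℕ) (t : List (List ℕ)) : row (tabInsert x t) = insF x (row t) := by
  funext i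
  induction t generalizing x i with
  | nil =>
    cases i with
    | zero => rfl
    | succ i => rfl
  | cons r t ih =>
    rw [tabInsert]
    rcases h : rowInsert x r with ⟨r', _ | b⟩
    · cases i with
      | zero => exact (congrArg Prod.fst h).symm
      | succ i => rw [insF, show row (r :: t) 0 = r from rfl, h]; rfl
    · cases i with
      | zero => exact (congrArg Prod.fst h).symm
      | succ i =>
        rw [insF, show row (r :: t) 0 = r from rfl, h]
        exact ih b i

theorem row_tabW (w : List ℕ) : row (tabW w) = insW w := by
  induction w using List.reverseRecOn with
  | nil => rfl
  | append_singleton w x ih => rw [tabW_concat, row_tabInsert, ih, insW_concat]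

theorem rowInsert_perm (x : ℕ) (r : List ℕ) :
    ((rowInsert x r).2.toList ++ (rowInsert x r).1).Perm (x :: r) := by
  induction r with
  | nil => rfl
  | cons e r ih =>
    unfold rowInsert
    split_ifs
    · exact List.Perm.swap ..
    · exact List.perm_middle.trans ((ih.cons e).trans (List.Perm.swap ..))

theorem tabInsert_perm (x : ℕ) (t : List (List ℕ)) :
    (tabInsert x t).flatten.Perm (x :: t.flatten) := by
  induction t generalizing x with
  | nil => rfl
  | cons r t ih =>
    rw [tabInsert]
    have hp := rowInsert_perm x r
    rcases h : rowInsert x r with ⟨r', _ | b⟩ <;> rw [h] at hp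
    · exact hp.append_right t.flatten
    · refine ((ih b).append_left r').trans ?_
      exact List.perm_middle.trans (hp.append_right t.flatten)

theorem tabW_perm (w : List ℕ) : (tabW w).flatten.Perm w := by
  induction w using List.reverseRecOn with
  | nil => rfl
  | append_singleton w x ih =>
    rw [tabW_concat]
    exact (tabInsert_perm x _).trans ((ih.cons x).trans (List.perm_append_singleton x w).symm)

theorem tabInsert_ne_nil {x : ℕ} {t : List (List ℕ)} (h : ∀ r ∈ t, r ≠ []) :
    ∀ r ∈ tabInsert x t, r ≠ [] := by
  induction t generalizing x with
  | nil => simp [tabInsert]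
  | cons r t ih =>
    rw [tabInsert]
    have h1 : (rowInsert x r).1 ≠ [] := List.ne_nil_of_mem (mem_rowInsert_self x r)
    have h2 : ∀ q ∈ t, q ≠ [] := fun q hq => h q (by simp [hq])
    rcases h' : rowInsert x r with ⟨r', _ | b⟩ <;> rw [h'] at h1
    · simpa using ⟨h1, h2⟩
    · simpa using ⟨h1, ih h2⟩

theorem tabW_ne_nil (w : List ℕ) : ∀ r ∈ tabW w, r ≠ [] := by
  induction w using List.reverseRecOn with
  | nil => simp [tabW]
  | append_singleton w x ih =>
    rw [tabW_concat]
    exact tabInsert_ne_nil ih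

/-- The family pads a list of rows with empty rows, so the list can be recovered only if it has no
empty row itself. -/
theorem row_injective {t t' : List (List ℕ)} (h : ∀ r ∈ t, r ≠ []) (h' : ∀ r ∈ t', r ≠ [])
    (he : row t = row t') : t = t' := by
  induction t generalizing t' with
  | nil =>
    cases t' with
    | nil => rfl
    | cons r t' => exact absurd (congrFun he 0).symm (h' r (by simp))
  | cons r t ih =>
    cases t' with
    | nil => exact absurd (congrFun he 0) (h r (by simp))
    | cons r' t' =>
      have h1 : r = r' := congrFun he 0
      have h2 : row t = row t' := funext fun i => congrFun he (i + 1)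
      rw [h1, ih (fun q hq => h q (by simp [hq])) (fun q hq => h' q (by simp [hq])) h2]

theorem tabW_eq_iff {w : List ℕ} {t : List (List ℕ)} (h : ∀ r ∈ t, r ≠ []) :
    tabW w = t ↔ insW w = row t := by
  rw [← row_tabW]
  exact ⟨fun h => h ▸ rfl, row_injective (tabW_ne_nil w) h⟩

/-! ### Hooks -/

/-- The family of rows of a hook with first row `r` and with `col` below it in the first column. -/
def hk (r col : List ℕ) : ℕ → List ℕ
  | 0 => r
  | i + 1 => (col[i]?).toList

/-- All rows but the first have at most one entry. -/
def HookRows (f : ℕ → List ℕ) : Prop := ∀ i, (f (i + 1)).length ≤ 1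

theorem hookRows_hk (r col : List ℕ) : HookRows (hk r col) := by
  intro i
  rw [hk]
  cases col[i]? <;> simp

theorem hk_injective {r r' col col' : List ℕ} (h : hk r col = hk r' col') : r = r' ∧ col = col' := by
  refine ⟨congrFun h 0, List.ext_getElem? fun i => ?_⟩
  have h1 : (col[i]?).toList = (col'[i]?).toList := congrFun h (i + 1)
  revert h1
  cases col[i]? <;> cases col'[i]? <;> simp

theorem hk_length_eq {r r' col col' : List ℕ} (h : ∀ i, (hk r col i).length = (hk r' col' i).length) :
    r.length = r'.length ∧ col.length = col'.length := by
  refine ⟨h 0, ?_⟩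
  have h1 : ∀ i, i < col.length ↔ i < col'.length := by
    intro i
    have h2 : (col[i]?).toList.length = (col'[i]?).toList.length := h (i + 1)
    constructor
    · intro hi
      by_contra hi'
      rw [List.getElem?_eq_getElem hi, List.getElem?_eq_none (not_lt.1 hi')] at h2
      simp at h2
    · intro hi
      by_contra hi'
      rw [List.getElem?_eq_getElem hi, List.getElem?_eq_none (not_lt.1 hi')] at h2
      simp at h2
  exact le_antisymm (not_lt.1 fun h => absurd ((h1 _).1 h) (lt_irrefl _))
    (not_lt.1 fun h => absurd ((h1 _).2 h) (lt_irrefl _))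

theorem hk_length_congr {r r' col col' : List ℕ} (h : r.length = r'.length)
    (h' : col.length = col'.length) (i : ℕ) : (hk r col i).length = (hk r' col' i).length := by
  cases i with
  | zero => exact h
  | succ i =>
    rw [hk, hk]
    by_cases hi : i < col.length
    · simp [List.getElem?_eq_getElem hi, List.getElem?_eq_getElem (h' ▸ hi)]
    · simp [List.getElem?_eq_none (not_lt.1 hi), List.getElem?_eq_none (h' ▸ not_lt.1 hi)]

theorem row_cons_singletons (r col : List ℕ) : row (r :: col.map fun c => [c]) = hk r col := by
  funext i
  cases i with
  | zero => rfl
  | succ i =>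
    change (col.map fun c => [c]).getD i [] = (col[i]?).toList
    rw [List.getD_eq_getElem?_getD, List.getElem?_map]
    cases col[i]? <;> rfl

theorem exists_singletons {t : List (List ℕ)} (h : ∀ r ∈ t, r.length = 1) :
    ∃ col : List ℕ, t = col.map fun c => [c] := by
  induction t with
  | nil => exact ⟨[], rfl⟩
  | cons r t ih =>
    obtain ⟨col, rfl⟩ := ih fun q hq => h q (by simp [hq])
    obtain ⟨c, rfl⟩ := List.length_eq_one_iff.1 (h r (by simp))
    exact ⟨c :: col, rfl⟩

theorem HookRows.exists_hk {u : List ℕ} (h : HookRows (insW u)) :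
    ∃ r col, insW u = hk r col ∧ (r ++ col).Perm u := by
  rcases ht : tabW u with _ | ⟨r, t⟩
  · have h1 := tabW_perm u
    rw [ht] at h1
    obtain rfl := List.nil_perm.1 h1
    refine ⟨[], [], ?_, .refl _⟩
    funext i
    cases i <;> rfl
  · have h1 : ∀ q ∈ t, q.length = 1 := by
      intro q hq
      refine le_antisymm ?_ (List.length_pos_iff.2 (tabW_ne_nil u q (by simp [ht, hq])))
      obtain ⟨i, hi, rfl⟩ := List.mem_iff_getElem.1 hq
      have h2 := h i
      rw [← row_tabW, ht] at h2
      simpa [row, hi] using h2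
    obtain ⟨col, rfl⟩ := exists_singletons h1
    refine ⟨r, col, ?_, ?_⟩
    · rw [← row_tabW, ht, row_cons_singletons]
    · have h2 := tabW_perm u
      rw [ht] at h2
      have h3 : ∀ c : List ℕ, (c.map fun c => [c]).flatten = c := by
        intro c
        induction c <;> simp_all
      simpa [h3] using h2

theorem perm_of_insW_eq_hk {u r col : List ℕ} (h : insW u = hk r col) : (r ++ col).Perm u := by
  obtain ⟨r', col', h1, h2⟩ := HookRows.exists_hk (u := u) (h ▸ hookRows_hk r col)
  obtain ⟨rfl, rfl⟩ := hk_injective (h.symm.trans h1)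
  exact h2

theorem col_sorted_of_below {r col : List ℕ} (h : ∀ i, Below (hk r col i) (hk r col (i + 1))) :
    col.Pairwise (· < ·) ∧ ∀ c ∈ col, ∃ a ∈ r, a < c := by
  induction col generalizing r with
  | nil => simp
  | cons c col ih =>
    have h1 := ih (r := [c]) fun i => by
      have := h (i + 1)
      cases i <;> exact this
    have h2 : ∀ y ∈ col, c < y := by simpa using h1.2
    refine ⟨List.pairwise_cons.2 ⟨h2, h1.1⟩, ?_⟩
    have h3 : Below r [c] := h 0
    cases r with
    | nil => exact h3.elim
    | cons a r =>
      intro y hy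
      refine ⟨a, by simp, ?_⟩
      rcases List.mem_cons.1 hy with rfl | hy
      · exact h3.1
      · exact h3.1.trans (h2 y hy)

/-! ### Insertion into a hook -/

theorem rowInsert_of_le {x : ℕ} {r : List ℕ} (h : ∀ y ∈ r, y ≤ x) :
    rowInsert x r = (r ++ [x], none) := by
  simpa [rowInsert] using rowInsert_append_of_le [] h

theorem rowInsert_of_lt {x z : ℕ} {l₁ l₂ : List ℕ} (h : ∀ y ∈ l₁, y ≤ x) (hz : x < z) :
    rowInsert x (l₁ ++ z :: l₂) = (l₁ ++ x :: l₂, some z) := by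
  rw [rowInsert_append_of_le _ h, rowInsert, if_pos hz]

theorem exists_split (x : ℕ) (r : List ℕ) :
    (∀ y ∈ r, y ≤ x) ∨ ∃ l₁ z l₂, r = l₁ ++ z :: l₂ ∧ (∀ y ∈ l₁, y ≤ x) ∧ x < z := by
  induction r with
  | nil => simp
  | cons e r ih =>
    rcases Nat.lt_or_ge x e with h | h
    · exact Or.inr ⟨[], e, r, rfl, by simp, h⟩
    · rcases ih with h1 | ⟨l₁, z, l₂, rfl, h1, h2⟩
      · exact Or.inl (by simpa using ⟨h, h1⟩)
      · exact Or.inr ⟨e :: l₁, z, l₂, rfl, by simpa using ⟨h, h1⟩, h2⟩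

theorem insF_hk_of_le {x : ℕ} {r : List ℕ} (col : List ℕ) (h : ∀ y ∈ r, y ≤ x) :
    insF x (hk r col) = hk (r ++ [x]) col := by
  funext i
  cases i with
  | zero => rw [insF, hk, rowInsert_of_le h]; rfl
  | succ i => rw [insF, hk, rowInsert_of_le h]; rfl

theorem insF_column {b : ℕ} {col : List ℕ} (hb : ∀ c ∈ col, b < c) (hc : col.Pairwise (· < ·)) :
    insF b (fun i => (col[i]?).toList) = fun i => ((b :: col)[i]?).toList := by
  funext i
  induction i generalizing b col with
  | zero =>
    cases col with
    | nil => rfl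
    | cons c col => simp [insF, rowInsert, hb c (by simp)]
  | succ i ih =>
    cases col with
    | nil => simp [insF, rowInsert]
    | cons c col =>
      rw [List.pairwise_cons] at hc
      simpa [insF, rowInsert, hb c (by simp)] using ih hc.1 hc.2

theorem insF_hk_of_lt {x z : ℕ} {l₁ l₂ col : List ℕ} (h : ∀ y ∈ l₁, y ≤ x) (hz : x < z)
    (hb : ∀ c ∈ col, z < c) (hc : col.Pairwise (· < ·)) :
    insF x (hk (l₁ ++ z :: l₂) col) = hk (l₁ ++ x :: l₂) (z :: col) := by
  funext i
  cases i with
  | zero => rw [insF, hk, rowInsert_of_lt h hz]; rfl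
  | succ i =>
    rw [insF, hk, rowInsert_of_lt h hz]
    exact congrFun (insF_column hb hc) i

/-- The two ways in which a hook can grow to a hook. -/
theorem insF_hk_cases {x : ℕ} {r col : List ℕ} (hc : col.Pairwise (· < ·))
    (h : HookRows (insF x (hk r col))) :
    ((∀ y ∈ r, y ≤ x) ∧ insF x (hk r col) = hk (r ++ [x]) col) ∨
    ∃ l₁ z l₂, r = l₁ ++ z :: l₂ ∧ (∀ y ∈ l₁, y ≤ x) ∧ x < z ∧ (∀ c ∈ col, z < c) ∧
      insF x (hk r col) = hk (l₁ ++ x :: l₂) (z :: col) := by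
  rcases exists_split x r with h1 | ⟨l₁, z, l₂, rfl, h1, h2⟩
  · exact Or.inl ⟨h1, insF_hk_of_le col h1⟩
  -- If the bumped `z` were not below the head of `col`, it would be appended to the second row,
  -- which would then have two cells.
  · have h3 : ∀ c ∈ col, z < c := by
      cases col with
      | nil => simp
      | cons c col =>
        rw [List.pairwise_cons] at hc
        have h4 : z < c := by
          by_contra h4
          have h5 := h 0
          rw [insF, hk, rowInsert_of_lt h1 h2] at h5
          simp [insF, hk, rowInsert, h4] at h5
        intro y hy
        rcases List.mem_cons.1 hy with rfl | hy
        · exact h4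
        · exact h4.trans (hc.1 y hy)
    exact Or.inr ⟨l₁, z, l₂, rfl, h1, h2, h3, insF_hk_of_lt h1 h2 h3 hc⟩

theorem length_le_insF (x : ℕ) (f : ℕ → List ℕ) (i : ℕ) : (f i).length ≤ (insF x f i).length := by
  induction i generalizing x f with
  | zero =>
    rw [insF, length_rowInsert]
    omega
  | succ i ih =>
    rw [insF]
    rcases (rowInsert x (f 0)).2 with _ | b
    · exact le_rfl
    · exact ih b fun j => f (j + 1)

theorem length_le_insL (l : List ℕ) (f : ℕ → List ℕ) (i : ℕ) : (f i).length ≤ (insL l f i).length := by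
  induction l generalizing f with
  | nil => exact le_rfl
  | cons x l ih => exact (length_le_insF x f i).trans (ih _)

theorem HookRows.of_append {p y : List ℕ} (h : HookRows (insW (p ++ y))) : HookRows (insW p) := by
  intro i
  have := h i
  rw [insW_append] at this
  exact (length_le_insL ..).trans this

theorem HookRows.exists_hk_sorted {u : List ℕ} (h : HookRows (insW u)) :
    ∃ r col, insW u = hk r col ∧ (r ++ col).Perm u ∧ r.Pairwise (· ≤ ·) ∧ col.Pairwise (· < ·) ∧
      ∀ c ∈ col, ∃ a ∈ r, a < c := by
  obtain ⟨r, col, h1, h2⟩ := h.exists_hk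
  have h3 := below_insW u
  have h4 := insW_sorted u 0
  rw [h1] at h3 h4
  exact ⟨r, col, h1, h2, h4, col_sorted_of_below h3⟩

/-- In a word with a hook-shaped tableau, the first row grows exactly at the ascents. -/
theorem HookRows.length_ascent {p : List ℕ} {x y : ℕ} (h : HookRows (insW (p ++ [x, y]))) :
    (insW (p ++ [x, y]) 0).length = (insW (p ++ [x]) 0).length + if x ≤ y then 1 else 0 := by
  rw [show p ++ [x, y] = (p ++ [x]) ++ [y] by simp] at h ⊢
  have hx := h.of_append
  obtain ⟨r, col, h1, -, h2, h3, -⟩ := hx.of_append.exists_hk_sorted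
  obtain ⟨r', col', h1', -, h2', h3', -⟩ := hx.exists_hk_sorted
  rw [insW_concat (p ++ [x]), h1'] at h ⊢
  rw [insW_concat, h1] at hx h1'
  have hxr : x ∈ r' := by
    have : x ∈ insF x (hk r col) 0 := mem_rowInsert_self x r
    rwa [h1'] at this
  rcases insF_hk_cases h3' h with ⟨h4, h5⟩ | ⟨l₁, z, l₂, rfl, h4, h5, h6, h7⟩
  · rw [h5, if_pos (h4 x hxr)]
    simp [hk]
  · rw [h7, if_neg]
    · simp [hk]
    -- Suppose `x ≤ y` and `y` bumps `z`, so `z > x`. If `x` was appended, nothing in the row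
    -- exceeds it. If `x` bumped `z'`, then `z` stands to the right of `x`, so `z ≥ z'`; but `z`
    -- must be smaller than the column entry `z'`.
    · intro hxy
      rcases insF_hk_cases h3 hx with ⟨h8, h9⟩ | ⟨m₁, z', m₂, rfl, h8, h9, h10, h11⟩
      · rw [h1'] at h9
        obtain ⟨h9, -⟩ := hk_injective h9
        have h10 : z ∈ r ++ [x] := by rw [← h9]; simp
        rcases List.mem_append.1 h10 with h10 | h10
        · have := h8 z h10
          omega
        · have : z = x := by simpa using h10
          omega
      · rw [h1'] at h11
        obtain ⟨h12, rfl⟩ := hk_injective h11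
        replace h12 : z ∈ m₁ ++ x :: m₂ := by rw [← h12]; simp
        have h13 := h6 z' (by simp)
        rw [List.pairwise_append, List.pairwise_cons] at h2
        rcases List.mem_append.1 h12 with h12 | h12
        · have := h8 z h12
          omega
        · rcases List.mem_cons.1 h12 with rfl | h12
          · omega
          · have := h2.2.1.1 z h12
            omega

/-- A hook shape is determined by its number of cells and the length of its first row. -/
theorem HookRows.length_congr {u u' : List ℕ} (h : HookRows (insW u)) (h' : HookRows (insW u'))
    (hl : u.length = u'.length) (h0 : (insW u 0).length = (insW u' 0).length) (i : ℕ) :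
    (insW u i).length = (insW u' i).length := by
  obtain ⟨r, col, h1, h2⟩ := h.exists_hk
  obtain ⟨r', col', h1', h2'⟩ := h'.exists_hk
  rw [h1, h1'] at h0 ⊢
  have h3 : r.length = r'.length := h0
  have h4 := h2.length_eq
  have h5 := h2'.length_eq
  rw [List.length_append] at h4 h5
  exact hk_length_congr h3 (by omega) i

theorem exists_split_last {β : ℕ} {r : List ℕ} (h : ∃ a ∈ r, a < β) :
    ∃ l₁ y l₂, r = l₁ ++ y :: l₂ ∧ y < β ∧ ∀ z ∈ l₂, β ≤ z := by
  induction r with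
  | nil => simp at h
  | cons e r ih =>
    by_cases h1 : ∃ a ∈ r, a < β
    · obtain ⟨l₁, y, l₂, rfl, h2, h3⟩ := ih h1
      exact ⟨e :: l₁, y, l₂, rfl, h2, h3⟩
    · push Not at h1
      obtain ⟨a, ha, hab⟩ := h
      rcases List.mem_cons.1 ha with rfl | ha
      · exact ⟨[], a, r, rfl, hab, h1⟩
      · exact absurd hab (h1 a ha).not_gt

/-- Reverse insertion for hooks: each hook tableau of the right shape is obtained with any given
hook evolution. -/
theorem exists_sameEvolution {u : List ℕ} (hu : HookRows (insW u)) {r col : List ℕ}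
    (hs : ∀ i, (insW u i).length = (hk r col i).length) (hr : r.Pairwise (· < ·))
    (hc : col.Pairwise (· < ·)) (hrc : ∀ c ∈ col, ∃ a ∈ r, a < c) (hd : ∀ c ∈ col, c ∉ r) :
    ∃ u', insW u' = hk r col ∧ SameEvolution u u' := by
  induction u using List.reverseRecOn generalizing r col with
  | nil =>
    have h1 : ∀ i, (hk [] [] i).length = (hk r col i).length := fun i => by
      rw [← hs i]
      cases i <;> rfl
    obtain ⟨h2, h3⟩ := hk_length_eq h1
    obtain rfl := List.length_eq_zero_iff.1 h2.symm
    obtain rfl := List.length_eq_zero_iff.1 h3.symm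
    refine ⟨[], ?_, .refl _⟩
    funext i
    cases i <;> rfl
  | append_singleton u x ih =>
    obtain ⟨ru, cu, h1, -, h2, h3, h4⟩ := hu.of_append.exists_hk_sorted
    have hu' := hu.of_append
    rw [insW_concat, h1] at hu
    have hs' := hs
    rw [insW_concat, h1] at hs
    rcases insF_hk_cases h3 hu with ⟨h5, h6⟩ | ⟨l₁, z, l₂, rfl, h5, -, h6, h7⟩
    · rw [h6] at hs
      obtain ⟨h7, h8⟩ := hk_length_eq hs
      -- The last step of `u` lengthened the row. It is undone in the target by removing the last,
      -- hence largest, row entry `y`.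
      rcases List.eq_nil_or_concat' r with rfl | ⟨r₀, y, rfl⟩
      · simp at h7
      simp only [List.length_append, List.length_singleton, Nat.add_right_cancel_iff] at h7
      rw [List.pairwise_append] at hr
      have h9 : ∀ a ∈ r₀, a < y := fun a ha => hr.2.2 a ha y (by simp)
      obtain ⟨u', h10, h11⟩ := ih hu' (r := r₀) (col := col)
        (fun i => by rw [h1]; exact hk_length_congr h7 h8 i) hr.1 hc
        (by
          intro c hcc
          obtain ⟨a, ha, hac⟩ := hrc c hcc
          rcases List.mem_append.1 ha with ha | ha
          · exact ⟨a, ha, hac⟩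
          · obtain rfl : a = y := by simpa using ha
            -- If `y` was the witness below `c`, any entry of `r₀` can replace it. Such an entry
            -- exists: the column of the model hook is nonempty, so its row is nonempty, and `r₀`
            -- has the length of that row.
            have h12 : cu ≠ [] := by
              rintro rfl
              simp [List.length_eq_zero_iff.1 h8.symm] at hcc
            obtain ⟨d, hd⟩ := List.exists_mem_of_ne_nil _ h12
            obtain ⟨e, he, -⟩ := h4 d hd
            have h13 : r₀ ≠ [] := by
              rintro rfl
              simp [List.length_eq_zero_iff.1 h7] at he
            obtain ⟨e', he'⟩ := List.exists_mem_of_ne_nil _ h13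
            exact ⟨e', he', (h9 e' he').trans hac⟩)
        (fun c hcc hcr => hd c hcc (by simp [hcr]))
      have h14 : insW (u' ++ [y]) = hk (r₀ ++ [y]) col := by
        rw [insW_concat, h10, insF_hk_of_le col fun a ha => (h9 a ha).le]
      exact ⟨u' ++ [y], h14, h11.concat fun i => by rw [h14, hs']⟩
    · rw [h7] at hs
      obtain ⟨h8, h9⟩ := hk_length_eq hs
      cases col with
      | nil => simp at h9
      | cons β col =>
        rw [List.pairwise_cons] at hc
        -- The last step of `u` lengthened the column. Reverse bumping sends the column head `β`
        -- back to the place of the last row entry `y < β`, and `y` becomes the inserted letter.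
        obtain ⟨m₁, y, m₂, rfl, h10, h11⟩ := exists_split_last (hrc β (by simp))
        rw [List.pairwise_append, List.pairwise_cons] at hr
        have hβ : ∀ z ∈ m₂, β < z := fun z hz =>
          lt_of_le_of_ne (h11 z hz) fun h => hd β (by simp) (by simp [h, hz])
        obtain ⟨u', h12, h13⟩ := ih hu' (r := m₁ ++ β :: m₂) (col := col)
          (fun i => by
            rw [h1]
            refine hk_length_congr ?_ (by simpa using h9) i
            simpa using h8)
          (by
            rw [List.pairwise_append, List.pairwise_cons]
            refine ⟨hr.1, ⟨hβ, hr.2.1.2⟩, fun a ha b hb => ?_⟩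
            have h14 : a < y := hr.2.2 a ha y (by simp)
            rcases List.mem_cons.1 hb with rfl | hb
            · exact h14.trans h10
            · exact h14.trans (h10.trans (hβ b hb)))
          hc.2 (fun c hcc => ⟨β, by simp, hc.1 c hcc⟩)
          (by
            intro c hcc hcm
            have h14 := hc.1 c hcc
            refine hd c (by simp [hcc]) ?_
            simp only [List.mem_append, List.mem_cons] at hcm ⊢
            rcases hcm with h | h | h
            · exact Or.inl h
            · omega
            · exact Or.inr (Or.inr h))
        have h14 : insW (u' ++ [y]) = hk (m₁ ++ y :: m₂) (β :: col) := by
          rw [insW_concat, h12, insF_hk_of_lt (fun a ha => (hr.2.2 a ha y (by simp)).le) h10 hc.1 hc.2]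
        exact ⟨u' ++ [y], h14, h13.concat fun i => by rw [h14, hs']⟩

/-! ### Adjacent swaps up to Knuth equivalence -/

/-- `w'` arises from `w` by swapping two adjacent letters that form an ascent. -/
def AscentSwap (w w' : List ℕ) : Prop :=
  ∃ P Y : List ℕ, ∃ a c : ℕ, a < c ∧ w = P ++ a :: c :: Y ∧ w' = P ++ c :: a :: Y

/-- Either an ascent swap, or a change of the word which preserves the insertion tableau. -/
def WordStep (w w' : List ℕ) : Prop := AscentSwap w w' ∨ insW w = insW w'

/-- Up to Knuth equivalence, `v` is equal to `u` or arises from `u` by an ascent swap. -/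
def KnuthSwap (u v : List ℕ) : Prop :=
  KnuthEquiv u v ∨ ∃ u' v', AscentSwap u' v' ∧ KnuthEquiv u u' ∧ KnuthEquiv v v'

theorem AscentSwap.congr {u v : List ℕ} (h : AscentSwap u v) (P Y : List ℕ) :
    AscentSwap (P ++ u ++ Y) (P ++ v ++ Y) := by
  obtain ⟨P', Y', a, c, h, rfl, rfl⟩ := h
  exact ⟨P ++ P', Y' ++ Y, a, c, h, by simp, by simp⟩

theorem KnuthSwap.congr {u v : List ℕ} (h : KnuthSwap u v) (P Y : List ℕ) :
    KnuthSwap (P ++ u ++ Y) (P ++ v ++ Y) := by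
  rcases h with h | ⟨u', v', h1, h2, h3⟩
  · exact Or.inl (h.congr P Y)
  · exact Or.inr ⟨_, _, h1.congr P Y, h2.congr P Y, h3.congr P Y⟩

theorem KnuthSwap.of_equiv {u v u' v' : List ℕ} (h : KnuthSwap u' v') (hu : KnuthEquiv u u')
    (hv : KnuthEquiv v v') : KnuthSwap u v := by
  rcases h with h | ⟨u'', v'', h1, h2, h3⟩
  · exact Or.inl (hu.trans (h.trans hv.symm))
  · exact Or.inr ⟨_, _, h1, hu.trans h2, hv.trans h3⟩

theorem KnuthSwap.reflTransGen {u v : List ℕ} (h : KnuthSwap u v) :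
    Relation.ReflTransGen WordStep u v := by
  rcases h with h | ⟨u', v', h1, h2, h3⟩
  · exact .single (Or.inr h.insW_eq)
  · exact .head (Or.inr h2.insW_eq) (.head (Or.inl h1) (.single (Or.inr h3.insW_eq.symm)))

/-- An ascent can be carried to the end. When `d` is appended to `p q` with `p ≤ q`, the word ends
in `q d` if `q ≤ d`, is equivalent to `q p d` if `p ≤ d < q`, and to `p d q` if `d < p`. -/
theorem decreasing_or_ascent (X : List ℕ) :
    X.Pairwise (· > ·) ∨ ∃ Z p q, p ≤ q ∧ KnuthEquiv X (Z ++ [p, q]) := by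
  induction X using List.reverseRecOn with
  | nil => simp
  | append_singleton X d ih =>
    rcases ih with h | ⟨Z, p, q, hpq, h⟩
    · by_cases hd : ∀ x ∈ X, d < x
      · exact Or.inl (List.pairwise_append.2 ⟨h, by simp, by simpa using hd⟩)
      · right
        push Not at hd
        obtain ⟨x, hx, hxd⟩ := hd
        rcases List.eq_nil_or_concat' X with rfl | ⟨Z, p, rfl⟩
        · simp at hx
        · refine ⟨Z, p, d, ?_, by simpa using KnuthEquiv.refl _⟩
          rcases List.mem_append.1 hx with hx | hx
          · exact ((List.pairwise_append.1 h).2.2 x hx p (by simp)).le.trans hxd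
          · obtain rfl : x = p := by simpa using hx
            exact hxd
    · right
      have h' : KnuthEquiv (X ++ [d]) (Z ++ [p, q, d]) := by simpa using h.append (.refl [d])
      rcases le_or_gt q d with hqd | hqd
      · exact ⟨Z ++ [p], q, d, hqd, by simpa using h'⟩
      · rcases le_or_gt p d with hpd | hpd
        · refine ⟨Z ++ [q], p, d, hpd, h'.trans ?_⟩
          simpa using (KnuthEquiv.refl Z).append (KnuthEquiv.acb hpd hqd [])
        · refine ⟨Z ++ [p], d, q, hqd.le, h'.trans ?_⟩
          simpa using (KnuthEquiv.refl Z).append (KnuthEquiv.bac hpd hpq []).symm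

/-- The mirror argument carries a descent to the front: before `q p` with `p < q`, a letter `d`
gives the descent `d q`, or the equivalent word `d p q`, or the equivalent word `q d p`. -/
theorem increasing_or_descent (X : List ℕ) :
    X.Pairwise (· ≤ ·) ∨ ∃ q p Z, p < q ∧ KnuthEquiv X (q :: p :: Z) := by
  induction X with
  | nil => simp
  | cons d X ih =>
    rcases ih with h | ⟨q, p, Z, hpq, h⟩
    · by_cases hd : ∀ x ∈ X, d ≤ x
      · exact Or.inl (List.pairwise_cons.2 ⟨hd, h⟩)
      · right
        push Not at hd
        obtain ⟨x, hx, hxd⟩ := hd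
        cases X with
        | nil => simp at hx
        | cons p Z =>
          refine ⟨d, p, Z, ?_, .refl _⟩
          rcases List.mem_cons.1 hx with rfl | hx
          · exact hxd
          · exact ((List.pairwise_cons.1 h).1 x hx).trans_lt hxd
    · right
      have h' := h.cons d
      rcases lt_or_ge q d with hqd | hqd
      · exact ⟨d, q, p :: Z, hqd, h'⟩
      · rcases lt_or_ge p d with hpd | hpd
        · exact ⟨d, p, q :: Z, hpd, h'.trans (KnuthEquiv.bac hpd hqd Z).symm⟩
        · exact ⟨q, d, p :: Z, hpd.trans_lt hpq, h'.trans (KnuthEquiv.acb hpd hpq Z)⟩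

/-- Each letter of `D` jumps over `c`, witnessed by the next smaller letter of `D ++ [m]`. -/
theorem KnuthEquiv.move_column {c m : ℕ} (hcm : c ≤ m) {D : List ℕ} (hD : D.Pairwise (· > ·))
    (hm : ∀ d ∈ D, m < d) : KnuthEquiv (c :: (D ++ [m])) (D ++ [c, m]) := by
  induction D with
  | nil => exact .refl _
  | cons d D ih =>
    rw [List.pairwise_cons] at hD
    have hd := hm d (by simp)
    have h1 : KnuthEquiv (c :: d :: (D ++ [m])) (d :: c :: (D ++ [m])) := by
      cases D with
      | nil => exact .acb hcm hd []
      | cons e D =>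
        have he := hm e (by simp)
        exact .acb (hcm.trans he.le) (hD.1 e (by simp)) _
    exact h1.trans ((ih hD.2 fun e he => hm e (by simp [he])).cons d)

/-- The letter `a` jumps over each letter of `E` from right to left, witnessed by the letter just
before it. -/
theorem KnuthEquiv.move_row {a m : ℕ} (ham : a < m) {E : List ℕ}
    (hE : (m :: E).Pairwise (· ≤ ·)) : KnuthEquiv (m :: (E ++ [a])) (m :: a :: E) := by
  induction E generalizing m with
  | nil => exact .refl _
  | cons e E ih =>
    rw [List.pairwise_cons] at hE
    have he := hE.1 e (by simp)
    exact ((ih (ham.trans_le he) hE.2).cons m).trans (KnuthEquiv.bac ham he E).symm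

/-- The words `b c X a` and `b a X c`, where `a < b < c` and the letters of `X` are larger. -/
theorem knuthSwap_suffix {a b c : ℕ} (hab : a < b) (hbc : b < c) (X : List ℕ)
    (hX : ∀ x ∈ X, c < x) : KnuthSwap (b :: c :: (X ++ [a])) (b :: a :: (X ++ [c])) := by
  induction hn : X.length generalizing X with
  | zero =>
    obtain rfl := List.length_eq_zero_iff.1 hn
    exact Or.inl (KnuthEquiv.bac hab hbc.le []).symm
  | succ n ih =>
    -- If `X = D m` is decreasing, then `D` can be carried to the front, and the two words become `D
    -- b a c m` and `D b a m c`, which differ by one ascent swap. Otherwise an ascent at the end of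
    -- `X` allows induction.
    rcases decreasing_or_ascent X with h | ⟨Z, p, q, hpq, h⟩
    · rcases List.eq_nil_or_concat' X with rfl | ⟨D, m, rfl⟩
      · simp at hn
      have hcm : c < m := hX m (by simp)
      rw [List.pairwise_append] at h
      have hm : ∀ d ∈ D, m < d := fun d hd => h.2.2 d hd m (by simp)
      right
      refine ⟨_, _, ⟨D ++ [b, a], [], c, m, hcm, rfl, rfl⟩, ?_, ?_⟩
      · have h1 := (KnuthEquiv.move_column hcm.le h.1 hm).congr [b] [a]
        have h2 := (KnuthEquiv.move_column hbc.le h.1 fun d hd => hcm.trans (hm d hd)).congr [] [m, a]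
        have h3 := (KnuthEquiv.bac (hab.trans hbc) hcm.le []).symm.congr (D ++ [b]) []
        have h4 := (KnuthEquiv.bac hab hbc.le []).symm.congr D [m]
        simp only [List.append_assoc, List.cons_append, List.nil_append, List.append_nil]
          at h1 h2 h3 h4 ⊢
        exact h1.trans (h2.trans (h3.trans h4))
      · have h1 := (KnuthEquiv.move_column ((hab.trans hbc).trans hcm).le h.1 hm).congr [b] [c]
        have h2 := (KnuthEquiv.acb (hab.trans hbc).le hcm []).congr (b :: D) []
        have h3 := (KnuthEquiv.move_column (hbc.trans hcm).le h.1 hm).congr [] [a, c]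
        have h4 := (KnuthEquiv.bac hab (hbc.trans hcm).le []).symm.congr D [c]
        simp only [List.append_assoc, List.cons_append, List.nil_append, List.append_nil]
          at h1 h2 h3 h4 ⊢
        exact h1.trans (h2.trans (h3.trans h4))
    · have hX' : ∀ x ∈ Z ++ [p, q], c < x := fun x hx => hX x (h.perm.mem_iff.2 hx)
      have hp : c < p := hX' p (by simp)
      have h1 := ih (Z ++ [p])
        (fun x hx => hX' x (by simp only [List.mem_append, List.mem_cons] at hx ⊢; tauto))
        (by have := h.perm.length_eq; simp only [List.length_append, List.length_cons] at this ⊢; simp_all)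
      -- With `p` as witness, `q` passes over the letter after it, `a` or `c`, and leaves the
      -- shorter word `Z p` between.
      refine (h1.congr [] [q]).of_equiv ?_ ?_
      · have h2 := h.congr [b, c] [a]
        have h3 := (KnuthEquiv.bac ((hab.trans hbc).trans hp) hpq []).symm.congr ([b, c] ++ Z) []
        simp only [List.append_assoc, List.cons_append, List.nil_append, List.append_nil] at h2 h3 ⊢
        exact h2.trans h3
      · have h2 := h.congr [b, a] [c]
        have h3 := (KnuthEquiv.bac hp hpq []).symm.congr ([b, a] ++ Z) []
        simp only [List.append_assoc, List.cons_append, List.nil_append, List.append_nil] at h2 h3 ⊢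
        exact h2.trans h3

/-- The words `c X a b` and `a X c b`, where `a < b < c` and the letters of `X` are larger. -/
theorem knuthSwap_prefix {a b c : ℕ} (hab : a < b) (hbc : b < c) (X : List ℕ)
    (hX : ∀ x ∈ X, c < x) : KnuthSwap (c :: (X ++ [a, b])) (a :: (X ++ [c, b])) := by
  have hac := hab.trans hbc
  induction hn : X.length generalizing X with
  | zero =>
    obtain rfl := List.length_eq_zero_iff.1 hn
    exact Or.inl (KnuthEquiv.acb hab.le hbc []).symm
  | succ n ih =>
    -- If `X = m E` is increasing, then `E` can be carried to the end, and the two words become `c m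
    -- a b E` and `m c a b E`. Otherwise the first letter of a descent leaves `X` to the left, with
    -- the second as witness.
    rcases increasing_or_descent X with h | ⟨q, p, Z, hpq, h⟩
    · cases X with
      | nil => simp at hn
      | cons m E =>
        have hcm : c < m := hX m (by simp)
        have hcE : (c :: E).Pairwise (· ≤ ·) :=
          List.pairwise_cons.2 ⟨fun y hy => (hX y (by simp [hy])).le, (List.pairwise_cons.1 h).2⟩
        right
        refine ⟨_, _, ⟨[], a :: b :: E, c, m, hcm, rfl, rfl⟩, ?_, ?_⟩
        · have h1 := (KnuthEquiv.move_row (hac.trans hcm) h).congr [c] [b]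
          have h2 := (KnuthEquiv.bac hac hcm.le (E ++ [b])).symm
          have h3 := (KnuthEquiv.move_row (hbc.trans hcm) h).congr [c, a] []
          have h4 := KnuthEquiv.bac hac hcm.le (b :: E)
          simp only [List.append_assoc, List.cons_append, List.nil_append, List.append_nil]
            at h1 h2 h3 h4 ⊢
          exact h1.trans (h2.trans (h3.trans h4))
        · have h1 := (KnuthEquiv.move_row hcm h).congr [a] [b]
          have h2 := (KnuthEquiv.move_row hbc hcE).congr [a, m] []
          have h3 := KnuthEquiv.acb hac.le hcm (b :: E)
          have h4 := (KnuthEquiv.acb hab.le hbc E).cons m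
          simp only [List.append_assoc, List.cons_append, List.nil_append, List.append_nil]
            at h1 h2 h3 h4 ⊢
          exact h1.trans (h2.trans (h3.trans h4))
    · have hX' : ∀ x ∈ q :: p :: Z, c < x := fun x hx => hX x (h.perm.mem_iff.2 hx)
      have hp : c < p := hX' p (by simp)
      have h1 := ih (p :: Z) (fun x hx => hX' x (List.mem_cons_of_mem _ hx))
        (by have := h.perm.length_eq; simp_all)
      refine (h1.congr [q] []).of_equiv ?_ ?_
      · have h2 := h.congr [c] [a, b]
        have h3 := KnuthEquiv.acb hp.le hpq (Z ++ [a, b])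
        simp only [List.cons_append, List.nil_append, List.append_nil] at h2 h3 ⊢
        exact h2.trans h3
      · have h2 := h.congr [a] [c, b]
        have h3 := KnuthEquiv.acb (hac.trans hp).le hpq (Z ++ [c, b])
        simp only [List.cons_append, List.nil_append, List.append_nil] at h2 h3 ⊢
        exact h2.trans h3

/-! ### Ascent swaps inside a hook class -/

/-- After the common letter `e`, both words have the same ascents, so a difference of one in the
first-row length persists to the end. -/
theorem HookRows.length_suffix {q q' y : List ℕ} {e : ℕ} (h : HookRows (insW (q ++ e :: y)))
    (h' : HookRows (insW (q' ++ e :: y)))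
    (hl : (insW (q ++ [e]) 0).length = (insW (q' ++ [e]) 0).length + 1) :
    (insW (q ++ e :: y) 0).length = (insW (q' ++ e :: y) 0).length + 1 := by
  induction y generalizing q q' e with
  | nil => exact hl
  | cons f y ih =>
    have e1 : ∀ q : List ℕ, q ++ e :: f :: y = (q ++ [e]) ++ f :: y := by simp
    have e2 : ∀ q : List ℕ, q ++ e :: f :: y = (q ++ [e, f]) ++ y := by simp
    have h1 := h
    have h1' := h'
    rw [e2] at h1 h1'
    have h2 := h1.of_append.length_ascent
    have h2' := h1'.of_append.length_ascent
    rw [e1] at h h' ⊢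
    rw [e1 q']
    refine ih h h' ?_
    simp only [List.append_assoc, List.cons_append, List.nil_append]
    omega

/-- An ascent swap inside a hook class has a witness next to it. -/
theorem exists_witness {p y : List ℕ} {a c : ℕ} (hac : a < c)
    (he : insW (p ++ a :: c :: y) = insW (p ++ c :: a :: y))
    (h : HookRows (insW (p ++ a :: c :: y))) :
    (∃ p₀ b, p = p₀ ++ [b] ∧ a < b ∧ b ≤ c) ∨ ∃ b y₀, y = b :: y₀ ∧ a ≤ b ∧ b < c := by
  by_contra hcon
  push Not at hcon
  obtain ⟨hp, hy⟩ := hcon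
  have h' : HookRows (insW (p ++ c :: a :: y)) := he ▸ h
  have e2 : ∀ a c : ℕ, p ++ a :: c :: y = (p ++ [a, c]) ++ y := by simp
  have h1 := (e2 a c ▸ h).of_append
  have h1' := (e2 c a ▸ h').of_append
  -- Without a witness on the left, the last letter of `p` compares in the same way with `a` and
  -- with `c`.
  have h2 : (insW (p ++ [a]) 0).length = (insW (p ++ [c]) 0).length := by
    rcases List.eq_nil_or_concat' p with rfl | ⟨p₀, b, rfl⟩
    · rfl
    · have e3 : ∀ a c : ℕ, p₀ ++ [b] ++ [a, c] = (p₀ ++ [b, a]) ++ [c] := by simp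
      have h3 := (e3 a c ▸ h1).of_append.length_ascent
      have h3' := (e3 c a ▸ h1').of_append.length_ascent
      have h4 := hp p₀ b rfl
      simp only [List.append_assoc, List.cons_append, List.nil_append]
      rw [h3, h3']
      congr 1
      split_ifs <;> omega
  have h3 := h1.length_ascent
  have h3' := h1'.length_ascent
  rw [if_pos hac.le] at h3
  rw [if_neg hac.not_ge] at h3'
  cases y with
  | nil =>
    have := congrArg List.length (congrFun he 0)
    omega
  | cons b y =>
    have h4 := hy b y rfl
    have e4 : ∀ a c : ℕ, p ++ a :: c :: b :: y = (p ++ [a, c]) ++ b :: y := by simp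
    have e5 : ∀ a c : ℕ, p ++ a :: c :: b :: y = (p ++ [a] ++ [c, b]) ++ y := by simp
    have h5 := (e5 a c ▸ h).of_append.length_ascent
    have h5' := (e5 c a ▸ h').of_append.length_ascent
    have h6 := congrArg List.length (congrFun he 0)
    rw [e4 a c] at h h6
    rw [e4 c a] at h' h6
    -- The ascent `a c` gains one cell over the descent `c a`. Without a witness on the right, the
    -- next letter cannot compensate, and the final first rows differ in length.
    have h7 := HookRows.length_suffix h h' (by
      simp only [List.append_assoc, List.cons_append, List.nil_append] at h5 h5' ⊢
      rw [h5, h5', h3, h3', h2]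
      split_ifs <;> omega)
    omega

theorem SameEvolution.append {q q' y y' : List ℕ} (h : SameEvolution q q')
    (hl : y.length = y'.length)
    (hy : ∀ m i, (insW (q ++ y.take m) i).length = (insW (q' ++ y'.take m) i).length) :
    SameEvolution (q ++ y) (q' ++ y') := by
  refine ⟨by simp [h.1, hl], fun m i => ?_⟩
  rw [List.take_append, List.take_append]
  rcases le_total m q.length with hm | hm
  · rw [Nat.sub_eq_zero_of_le hm, Nat.sub_eq_zero_of_le (h.1 ▸ hm)]
    simpa using h.2 m i
  · rw [show q.take m = q from List.take_of_length_le hm,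
      show q'.take m = q' from List.take_of_length_le (h.1 ▸ hm), h.1]
    exact hy _ i

/-- Replacing a triple by one with the same insertion effect alters the shapes only at the two
stages inside it. For hooks these are determined by the ascents of the new triples, read backwards
from the common shape after the triple. -/
theorem SameEvolution.triple {p p' t t' y y' : List ℕ} {s₁ s₂ s₃ s₁' s₂' s₃' : ℕ}
    (h : SameEvolution (p ++ t ++ y) (p' ++ t' ++ y')) (hp : p.length = p'.length)
    (ht : t.length = 3) (ht' : t'.length = 3)
    (hs : insW (p ++ t) = insW (p ++ [s₁, s₂, s₃]))
    (hs' : insW (p' ++ t') = insW (p' ++ [s₁', s₂', s₃']))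
    (h₁ : s₁ ≤ s₂ ↔ s₁' ≤ s₂') (h₂ : s₂ ≤ s₃ ↔ s₂' ≤ s₃')
    (hh : HookRows (insW (p ++ t ++ y))) (hh' : HookRows (insW (p' ++ t' ++ y'))) :
    SameEvolution (p ++ [s₁, s₂, s₃] ++ y) (p' ++ [s₁', s₂', s₃'] ++ y') := by
  have hpt : (p ++ t).length = (p' ++ t').length := by simp [hp, ht, ht']
  have hyl : y.length = y'.length := by
    have := h.1
    simp only [List.length_append] at this
    omega
  have hk := hh.of_append
  have hk' := hh'.of_append
  have e0 := (h.of_append hpt).length_eq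
  rw [hs] at hk e0
  rw [hs'] at hk' e0
  have e1 : ∀ (p : List ℕ) (a b c : ℕ), p ++ [a, b, c] = p ++ [a] ++ [b, c] := by simp
  have e2 : ∀ (p : List ℕ) (a b : ℕ), p ++ [a, b] = p ++ [a] ++ [b] := by simp
  have e3 : ∀ (p : List ℕ) (a b c : ℕ), p ++ [a, b, c] = p ++ [a, b] ++ [c] := by simp
  have k3 := (e1 .. ▸ hk).length_ascent
  have k3' := (e1 .. ▸ hk').length_ascent
  have k2 := (e3 .. ▸ hk).of_append
  have k2' := (e3 .. ▸ hk').of_append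
  have l2 := k2.length_ascent
  have l2' := k2'.length_ascent
  have f0 := e0 0
  rw [← e1, ← e2] at k3 k3'
  have m2 : (insW (p ++ [s₁, s₂]) 0).length = (insW (p' ++ [s₁', s₂']) 0).length := by
    simp only [h₂] at k3
    omega
  have m1 : (insW (p ++ [s₁]) 0).length = (insW (p' ++ [s₁']) 0).length := by
    simp only [h₁] at l2
    omega
  have k1 := (e2 .. ▸ k2).of_append
  have k1' := (e2 .. ▸ k2').of_append
  have n0 : SameEvolution p p' := (h.of_append hpt).of_append hp
  have n1 : SameEvolution (p ++ [s₁]) (p' ++ [s₁']) :=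
    n0.concat (k1.length_congr k1' (by simp [hp]) m1)
  have n2 : SameEvolution (p ++ [s₁, s₂]) (p' ++ [s₁', s₂']) := by
    rw [e2 p, e2 p']
    exact n1.concat (by rw [← e2, ← e2]; exact k2.length_congr k2' (by simp [hp]) m2)
  have n3 : SameEvolution (p ++ [s₁, s₂, s₃]) (p' ++ [s₁', s₂', s₃']) := by
    rw [e3 p, e3 p']
    exact n2.concat (by rw [← e3, ← e3]; exact e0)
  refine n3.append hyl fun m i => ?_
  rw [insW_append _ (y.take m), insW_append _ (y'.take m), ← hs, ← hs',
    ← insW_append (p ++ t) (y.take m), ← insW_append (p' ++ t') (y'.take m)]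
  have := h.2 ((p ++ t).length + m) i
  rwa [List.take_length_add_append, hpt, List.take_length_add_append] at this

/-! ### Translation of words -/

/-- The hook with first row `r` and rest of the first column `col` is a tableau with distinct
entries, all at most `k`. -/
structure IsHookTableau (k : ℕ) (r col : List ℕ) : Prop where
  row_lt : r.Pairwise (· < ·)
  col_lt : col.Pairwise (· < ·)
  below : ∀ c ∈ col, ∃ a ∈ r, a < c
  disjoint : ∀ c ∈ col, c ∉ r
  le : ∀ x ∈ r ++ col, x ≤ k

theorem IsHookTableau.nodup {k : ℕ} {r col : List ℕ} (h : IsHookTableau k r col) :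
    (r ++ col).Nodup := by
  refine List.nodup_append'.2 ⟨h.row_lt.imp fun h => h.ne, h.col_lt.imp fun h => h.ne, ?_⟩
  intro x hx hx'
  exact h.disjoint x hx' hx

/-- `w'` arises from `w` by replacing the small letters, in such a way that the tableau of the
small letters has the same evolution and becomes `g`. -/
def Translates (k : ℕ) (g : ℕ → List ℕ) (w w' : List ℕ) : Prop :=
  SameLarge k w w' ∧ SameEvolution (small k w) (small k w') ∧ insW (small k w') = g

theorem SameLarge.append {k : ℕ} {p p' y y' : List ℕ} (h : SameLarge k p p')
    (h' : SameLarge k y y') : SameLarge k (p ++ y) (p' ++ y') := List.rel_append h h'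

theorem SameLarge.small_cons {k x x' : ℕ} {y y' : List ℕ} (h : SameLarge k y y') (hx : x ≤ k)
    (hx' : x' ≤ k) : SameLarge k (x :: y) (x' :: y') := .cons (Or.inl ⟨hx, hx'⟩) h

theorem SameLarge.eq_of_large {k : ℕ} {X X' : List ℕ} (h : SameLarge k X X')
    (hX : ∀ x ∈ X, k < x) : X = X' := by
  induction h with
  | nil => rfl
  | cons h _ ih =>
    have h1 := hX _ List.mem_cons_self
    rcases h with h | ⟨-, rfl⟩
    · omega
    · rw [ih fun x hx => hX x (by simp [hx])]

theorem SameLarge.of_cons_small {k x : ℕ} {y w : List ℕ} (h : SameLarge k (x :: y) w)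
    (hx : x ≤ k) : ∃ x' y', x' ≤ k ∧ SameLarge k y y' ∧ w = x' :: y' := by
  cases h with
  | cons h1 h2 => exact ⟨_, _, by omega, h2, rfl⟩

theorem exists_sameLarge {k : ℕ} {w u : List ℕ} (hl : (small k w).length = u.length)
    (hu : ∀ x ∈ u, x ≤ k) : ∃ w', SameLarge k w w' ∧ small k w' = u := by
  induction w generalizing u with
  | nil =>
    obtain rfl := List.length_eq_zero_iff.1 hl.symm
    exact ⟨[], .nil, rfl⟩
  | cons x w ih =>
    rcases le_or_gt x k with hx | hx
    · rw [small_cons_of_le hx] at hl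
      cases u with
      | nil => simp at hl
      | cons y u =>
        have hy := hu y (by simp)
        obtain ⟨w', h1, h2⟩ := ih (u := u) (by simpa using hl) fun z hz => hu z (by simp [hz])
        exact ⟨y :: w', h1.small_cons hx hy, by rw [small_cons_of_le hy, h2]⟩
    · rw [small_cons_of_lt hx] at hl
      obtain ⟨w', h1, h2⟩ := ih hl hu
      exact ⟨x :: w', .cons (Or.inr ⟨hx, rfl⟩) h1, by rw [small_cons_of_lt hx, h2]⟩

/-- Reverse insertion yields the new small word, and its letters are placed in the small positions
of `w`. -/
theorem exists_translates {k : ℕ} {f : ℕ → List ℕ} {r col : List ℕ} (hg : IsHookTableau k r col)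
    (hf : HookRows f) (hs : ∀ i, (f i).length = (hk r col i).length) {w : List ℕ}
    (hw : insW (small k w) = f) : ∃ w', Translates k (hk r col) w w' := by
  obtain ⟨u, h1, h2⟩ := exists_sameEvolution (hw ▸ hf) (hw ▸ hs) hg.row_lt hg.col_lt hg.below
    hg.disjoint
  obtain ⟨w', h3, rfl⟩ := exists_sameLarge h2.1 fun x hx =>
    hg.le x ((perm_of_insW_eq_hk h1).mem_iff.2 hx)
  exact ⟨w', h3, h2, h1⟩

/-- The large part is read off from the common tableau of `w` and `v` by cancelling the small part
`f`, and it reappears next to `g` in both translated words. With `v = w` this shows that all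
translations of one word have the same tableau. -/
theorem Translates.insW_congr {k : ℕ} {f g : ℕ → List ℕ} {w v w' v' : List ℕ}
    (h : Translates k g w w') (h' : Translates k g v v') (hw : insW (small k w) = f)
    (hv : insW (small k v) = f) (he : insW w = insW v) : insW w' = insW v' := by
  obtain ⟨B, -, h1, h2⟩ := insW_glue h.1 h.2.1
  obtain ⟨C, -, h3, h4⟩ := insW_glue h'.1 h'.2.1
  have : B = C := by
    funext i
    have := congrFun he i
    rw [h1, h3, hw, hv] at this
    exact List.append_cancel_left this
  rw [h2, h4, h.2.2, h'.2.2, this]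

theorem small_eq_cons {k b : ℕ} {Y y : List ℕ} (h : small k Y = b :: y) :
    ∃ X Y', Y = X ++ b :: Y' ∧ (∀ x ∈ X, k < x) ∧ b ≤ k ∧ small k Y' = y := by
  obtain ⟨X, Y', h1, h2, h3, h4⟩ := List.filter_eq_cons_iff.1 h
  exact ⟨X, Y', h1, by simpa using h2, by simpa using h3, h4⟩

theorem small_eq_concat {k b : ℕ} {P p : List ℕ} (h : small k P = p ++ [b]) :
    ∃ P' X, P = P' ++ b :: X ∧ (∀ x ∈ X, k < x) ∧ b ≤ k ∧ small k P' = p := by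
  obtain ⟨P', Z, h1, h2, h3⟩ := List.filter_eq_append_iff.1 h
  obtain ⟨X, X', rfl, h4, h5, h6⟩ := small_eq_cons h3
  refine ⟨P' ++ X, X', by simpa using h1, ?_, h5, ?_⟩
  · simpa [small] using h6
  · rw [small_append, small_eq_nil h4, List.append_nil]
    exact h2

theorem small_middle {k : ℕ} (P X Y t t' : List ℕ) (hX : ∀ x ∈ X, k < x) (ht : ∀ x ∈ t, x ≤ k)
    (ht' : ∀ x ∈ t', x ≤ k) :
    small k (P ++ t ++ X ++ t' ++ Y) = small k P ++ (t ++ t') ++ small k Y := by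
  have h : ∀ s : List ℕ, (∀ x ∈ s, x ≤ k) → small k s = s := fun s hs =>
    List.filter_eq_self.2 fun x hx => by simpa using hs x hx
  simp only [small_append, small_eq_nil hX, h t ht, h t' ht', List.append_assoc, List.nil_append]

theorem nodup_triple {p y : List ℕ} {d e f : ℕ} (h : (p ++ [d, e, f] ++ y).Nodup) :
    d ≠ e ∧ d ≠ f ∧ e ≠ f := by
  have h1 : [d, e, f].Nodup := (List.nodup_append'.1 (List.nodup_append'.1 h).1).2.1
  simp at h1
  tauto

/-- In a hook evolution the ascents can be read off from the lengths of the first row. -/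
theorem ascents_of_sameEvolution {p p' y y' : List ℕ} {d e f d' e' f' : ℕ}
    (h : SameEvolution (p ++ [d, e, f] ++ y) (p' ++ [d', e', f'] ++ y'))
    (hp : p.length = p'.length) (hh : HookRows (insW (p ++ [d, e, f] ++ y)))
    (hh' : HookRows (insW (p' ++ [d', e', f'] ++ y'))) :
    (d ≤ e ↔ d' ≤ e') ∧ (e ≤ f ↔ e' ≤ f') := by
  have e1 : ∀ (p : List ℕ) (a b c : ℕ), p ++ [a, b, c] = p ++ [a] ++ [b, c] := by simp
  have e2 : ∀ (p : List ℕ) (a b : ℕ), p ++ [a, b] = p ++ [a] ++ [b] := by simp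
  have e3 : ∀ (p : List ℕ) (a b c : ℕ), p ++ [a, b, c] = p ++ [a, b] ++ [c] := by simp
  have n3 := h.of_append (by simp [hp])
  have n2 := (e3 .. ▸ e3 p .. ▸ n3).of_append (by simp [hp])
  have n1 := (e2 .. ▸ e2 p .. ▸ n2).of_append (by simp [hp])
  have k3 := hh.of_append
  have k3' := hh'.of_append
  have k2 := (e3 .. ▸ k3).of_append
  have k2' := (e3 .. ▸ k3').of_append
  have l3 := (e1 .. ▸ k3).length_ascent
  have l3' := (e1 .. ▸ k3').length_ascent
  have l2 := k2.length_ascent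
  have l2' := k2'.length_ascent
  rw [← e1, ← e2] at l3 l3'
  have a3 := n3.length_eq 0
  have a2 := n2.length_eq 0
  have a1 := n1.length_eq 0
  constructor
  · split_ifs at l2 l2' <;> omega
  · split_ifs at l3 l3' <;> omega

section

variable {k : ℕ} {r r' col col' : List ℕ} {w v : List ℕ}

/-- Translation of an ascent swap `a c X b → c a X b` of small letters, with `a < b < c`. -/
theorem exists_translates_acb (hg : IsHookTableau k r' col') (hr : r.length = r'.length)
    (hc : col.length = col'.length) {P X Y : List ℕ} {a b c : ℕ} (hab : a < b) (hbc : b < c)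
    (hck : c ≤ k) (hX : ∀ x ∈ X, k < x)
    (hw : insW (small k (P ++ [a, c] ++ X ++ [b] ++ Y)) = hk r col) :
    ∃ w' v', Translates k (hk r' col') (P ++ [a, c] ++ X ++ [b] ++ Y) w' ∧
      Translates k (hk r' col') (P ++ [c, a] ++ X ++ [b] ++ Y) v' ∧
      Relation.ReflTransGen WordStep w' v' := by
  have hak : a ≤ k := by omega
  have hbk : b ≤ k := by omega
  obtain ⟨w', h1, h2, h3⟩ := exists_translates hg (hookRows_hk r col) (hk_length_congr hr hc) hw
  obtain ⟨Q₁, Y', h4, hY, rfl⟩ := h1.of_append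
  obtain ⟨Q₂, Z', h5, h6, rfl⟩ := h4.of_append
  obtain ⟨Q₃, X', h7, h8, rfl⟩ := h5.of_append
  obtain ⟨P', Z, hP, h9, rfl⟩ := h7.of_append
  obtain rfl := h8.eq_of_large hX
  obtain ⟨f, _, hfk, h10, rfl⟩ := h6.of_cons_small hbk
  cases h10
  obtain ⟨d, _, hdk, h11, rfl⟩ := h9.of_cons_small hak
  obtain ⟨e, _, hek, h12, rfl⟩ := h11.of_cons_small hck
  cases h12
  have hu := hw
  have hnd : (small k (P' ++ [d, e] ++ X ++ [f] ++ Y')).Nodup :=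
    (perm_of_insW_eq_hk h3).nodup_iff.1 hg.nodup
  have hs : ∀ (P Y : List ℕ) {x y z : ℕ}, x ≤ k → y ≤ k → z ≤ k →
      small k (P ++ [x, y] ++ X ++ [z] ++ Y) = small k P ++ [x, y, z] ++ small k Y := by
    intro P Y x y z hx hy hz
    exact small_middle P X Y [x, y] [z] hX (by simp [hx, hy]) (by simp [hz])
  rw [hs _ _ hak hck hbk] at hu
  have h3' := h3
  have h2' := h2
  rw [hs _ _ hdk hek hfk] at h3' hnd
  rw [hs _ _ hak hck hbk, hs _ _ hdk hek hfk] at h2'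
  have hH : HookRows (insW (small k P ++ [a, c, b] ++ small k Y)) := hu ▸ hookRows_hk r col
  have hH' : HookRows (insW (small k P' ++ [d, e, f] ++ small k Y')) := h3' ▸ hookRows_hk r' col'
  obtain ⟨i1, i2⟩ := ascents_of_sameEvolution h2' hP.small_length hH hH'
  obtain ⟨j1, j2, j3⟩ := nodup_triple hnd
  have hde : d < e := lt_of_le_of_ne (i1.1 (hab.trans hbc).le) j1
  have hfe : f < e := by
    by_contra h
    have := i2.2 (not_lt.1 h)
    omega
  have hL : ∀ x ∈ X, e < x := fun x hx => hek.trans_lt (hX x hx)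
  -- The swapped small triple `c a b` has a descent followed by an ascent. Any word Knuth equivalent
  -- to `d e f` with this pattern translates it.
  have hT : ∀ {s₁ s₂ s₃ : ℕ}, s₁ ≤ k → s₂ ≤ k → s₃ ≤ k →
      KnuthEquiv [d, e, f] [s₁, s₂, s₃] → s₂ < s₁ → s₂ ≤ s₃ →
      Translates k (hk r' col') (P ++ [c, a] ++ X ++ [b] ++ Y)
        (P' ++ [s₁, s₂] ++ X ++ [s₃] ++ Y') := by
    intro s₁ s₂ s₃ hs₁ hs₂ hs₃ hE h12 h23
    refine ⟨((((hP.append ((SameLarge.small_cons .nil hak hs₂).small_cons hck hs₁)).append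
      (List.forall₂_same.2 fun x hx => Or.inr ⟨hX x hx, rfl⟩)).append
      (SameLarge.small_cons .nil hbk hs₃)).append hY), ?_, ?_⟩
    · rw [hs _ _ hck hak hbk, hs _ _ hs₁ hs₂ hs₃]
      refine h2'.triple hP.small_length rfl rfl ?_ ?_ ?_ ?_ hH hH'
      · simpa using ((KnuthEquiv.acb hab.le hbc []).congr (small k P) []).insW_eq
      · simpa using (hE.congr (small k P') []).insW_eq
      · omega
      · omega
    · rw [hs _ _ hs₁ hs₂ hs₃, ← h3']
      exact (hE.congr (small k P') (small k Y')).insW_eq.symm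
  -- If `d < f < e`, the relation has the original type, and `d`, `e` are adjacent in the full word.
  -- If `f < d < e`, it is `d e f ~ d f e`, and the letters `e`, `f` are separated by `X`.
  rcases lt_or_gt_of_ne j2 with hdf | hdf
  · refine ⟨_, P' ++ [e, d] ++ X ++ [f] ++ Y', ⟨h1, h2, h3⟩,
      hT hek hdk hfk (.acb hdf.le hfe []) hde hdf.le, .single (Or.inl ?_)⟩
    exact ⟨P', X ++ [f] ++ Y', d, e, hde, by simp, by simp⟩
  · refine ⟨_, P' ++ [d, f] ++ X ++ [e] ++ Y', ⟨h1, h2, h3⟩,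
      hT hdk hfk hek (KnuthEquiv.bac hdf hde.le []).symm hdf hfe.le, ?_⟩
    have := ((knuthSwap_suffix hdf hde X hL).congr P' Y').reflTransGen
    simpa using this

/-- Translation of an ascent swap `b X a c → b X c a` of small letters, with `a < b < c`. -/
theorem exists_translates_bac (hg : IsHookTableau k r' col') (hr : r.length = r'.length)
    (hc : col.length = col'.length) {P X Y : List ℕ} {a b c : ℕ} (hab : a < b) (hbc : b < c)
    (hck : c ≤ k) (hX : ∀ x ∈ X, k < x)
    (hw : insW (small k (P ++ [b] ++ X ++ [a, c] ++ Y)) = hk r col) :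
    ∃ w' v', Translates k (hk r' col') (P ++ [b] ++ X ++ [a, c] ++ Y) w' ∧
      Translates k (hk r' col') (P ++ [b] ++ X ++ [c, a] ++ Y) v' ∧
      Relation.ReflTransGen WordStep w' v' := by
  have hak : a ≤ k := by omega
  have hbk : b ≤ k := by omega
  obtain ⟨w', h1, h2, h3⟩ := exists_translates hg (hookRows_hk r col) (hk_length_congr hr hc) hw
  obtain ⟨Q₁, Y', h4, hY, rfl⟩ := h1.of_append
  obtain ⟨Q₂, Z', h5, h6, rfl⟩ := h4.of_append
  obtain ⟨Q₃, X', h7, h8, rfl⟩ := h5.of_append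
  obtain ⟨P', Z, hP, h9, rfl⟩ := h7.of_append
  obtain rfl := h8.eq_of_large hX
  obtain ⟨f, _, hfk, h10, rfl⟩ := h9.of_cons_small hbk
  cases h10
  obtain ⟨d, _, hdk, h11, rfl⟩ := h6.of_cons_small hak
  obtain ⟨e, _, hek, h12, rfl⟩ := h11.of_cons_small hck
  cases h12
  have hu := hw
  have hnd : (small k (P' ++ [f] ++ X ++ [d, e] ++ Y')).Nodup :=
    (perm_of_insW_eq_hk h3).nodup_iff.1 hg.nodup
  have hs : ∀ (P Y : List ℕ) {x y z : ℕ}, x ≤ k → y ≤ k → z ≤ k →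
      small k (P ++ [x] ++ X ++ [y, z] ++ Y) = small k P ++ [x, y, z] ++ small k Y := by
    intro P Y x y z hx hy hz
    exact small_middle P X Y [x] [y, z] hX (by simp [hx]) (by simp [hy, hz])
  rw [hs _ _ hbk hak hck] at hu
  have h3' := h3
  have h2' := h2
  rw [hs _ _ hfk hdk hek] at h3' hnd
  rw [hs _ _ hbk hak hck, hs _ _ hfk hdk hek] at h2'
  have hH : HookRows (insW (small k P ++ [b, a, c] ++ small k Y)) := hu ▸ hookRows_hk r col
  have hH' : HookRows (insW (small k P' ++ [f, d, e] ++ small k Y')) := h3' ▸ hookRows_hk r' col'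
  obtain ⟨i1, i2⟩ := ascents_of_sameEvolution h2' hP.small_length hH hH'
  obtain ⟨j1, j2, j3⟩ := nodup_triple hnd
  have hde : d < e := lt_of_le_of_ne (i2.1 (hab.trans hbc).le) j3
  have hdf : d < f := by
    by_contra h
    have := i1.2 (not_lt.1 h)
    omega
  have hL : ∀ x ∈ X, f < x := fun x hx => hfk.trans_lt (hX x hx)
  have hT : ∀ {s₁ s₂ s₃ : ℕ}, s₁ ≤ k → s₂ ≤ k → s₃ ≤ k →
      KnuthEquiv [f, d, e] [s₁, s₂, s₃] → s₁ ≤ s₂ → s₃ < s₂ →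
      Translates k (hk r' col') (P ++ [b] ++ X ++ [c, a] ++ Y)
        (P' ++ [s₁] ++ X ++ [s₂, s₃] ++ Y') := by
    intro s₁ s₂ s₃ hs₁ hs₂ hs₃ hE h12 h23
    refine ⟨((((hP.append (SameLarge.small_cons .nil hbk hs₁)).append
      (List.forall₂_same.2 fun x hx => Or.inr ⟨hX x hx, rfl⟩)).append
      ((SameLarge.small_cons .nil hak hs₃).small_cons hck hs₂)).append hY), ?_, ?_⟩
    · rw [hs _ _ hbk hck hak, hs _ _ hs₁ hs₂ hs₃]
      refine h2'.triple hP.small_length rfl rfl ?_ ?_ ?_ ?_ hH hH'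
      · simpa using ((KnuthEquiv.bac hab hbc.le []).congr (small k P) []).insW_eq
      · simpa using (hE.congr (small k P') []).insW_eq
      · omega
      · omega
    · rw [hs _ _ hs₁ hs₂ hs₃, ← h3']
      exact (hE.congr (small k P') (small k Y')).insW_eq.symm
  -- If `d < f < e`, the adjacent letters `d`, `e` are swapped. If `d < e < f`, the relation becomes
  -- `f d e ~ d f e`, with `X` between `f` and `d`.
  rcases lt_or_gt_of_ne j2 with hfe | hfe
  · refine ⟨_, P' ++ [f] ++ X ++ [e, d] ++ Y', ⟨h1, h2, h3⟩,
      hT hfk hek hdk (.bac hdf hfe.le []) hfe.le hde, .single (Or.inl ?_)⟩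
    exact ⟨P' ++ [f] ++ X, Y', d, e, hde, by simp, by simp⟩
  · refine ⟨_, P' ++ [d] ++ X ++ [f, e] ++ Y', ⟨h1, h2, h3⟩,
      hT hdk hfk hek (KnuthEquiv.acb hde.le hfe []).symm hdf.le hfe, ?_⟩
    have := ((knuthSwap_prefix hde hfe X hL).congr P' Y').reflTransGen
    simpa using this

/-- If `c` is large, the small word is unaffected and the same positions can be swapped after
translation. Otherwise the swap is an elementary Knuth relation on the small word, and the position
of its witness selects one of the two preceding cases. -/
theorem exists_translates_ascentSwap (hg : IsHookTableau k r' col') (hr : r.length = r'.length)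
    (hc : col.length = col'.length) (hwv : AscentSwap w v) (hnd : w.Nodup)
    (hw : insW (small k w) = hk r col) (hv : insW (small k v) = hk r col) :
    ∃ w' v', Translates k (hk r' col') w w' ∧ Translates k (hk r' col') v v' ∧
      Relation.ReflTransGen WordStep w' v' := by
  obtain ⟨P, Y, a, c, hac, rfl, rfl⟩ := hwv
  rcases lt_or_ge k c with hck | hck
  · obtain ⟨w', h1, h2, h3⟩ := exists_translates hg (hookRows_hk r col) (hk_length_congr hr hc) hw
    obtain ⟨P', Z, hP, h4, rfl⟩ := h1.of_append
    cases h4 with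
    | @cons _ a' _ _ h5 h6 =>
      cases h6 with
      | @cons _ c' _ Y' h7 h8 =>
        obtain rfl : c = c' := by omega
        have hs : ∀ (P Y : List ℕ) (a : ℕ),
            small k (P ++ c :: a :: Y) = small k (P ++ a :: c :: Y) := by
          intro P Y a
          rw [small_append, small_append, small_cons_of_lt hck]
          congr 1
          rcases le_or_gt a k with h | h
          · rw [small_cons_of_le h, small_cons_of_le h, small_cons_of_lt hck]
          · rw [small_cons_of_lt h, small_cons_of_lt h, small_cons_of_lt hck]
        refine ⟨_, P' ++ c :: a' :: Y', ⟨h1, h2, h3⟩, ⟨hP.append (.cons h7 (.cons h5 h8)), ?_, ?_⟩,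
          .single (Or.inl ⟨P', Y', a', c, by omega, rfl, rfl⟩)⟩
        · rwa [hs, hs]
        · rwa [hs]
  · have hak : a ≤ k := by omega
    have e1 : ∀ {a c : ℕ}, a ≤ k → c ≤ k →
        small k (P ++ a :: c :: Y) = small k P ++ a :: c :: small k Y := by
      intro a c ha hc
      rw [small_append, small_cons_of_le ha, small_cons_of_le hc]
    have hw' := hw
    have hv' := hv
    rw [e1 hak hck] at hw'
    rw [e1 hck hak] at hv'
    have hnd' := hnd
    rw [List.nodup_append', List.nodup_cons, List.nodup_cons] at hnd'
    rcases exists_witness hac (hw'.trans hv'.symm) (hw' ▸ hookRows_hk r col) with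
      ⟨p, b, h1, h2, h3⟩ | ⟨b, y, h1, h2, h3⟩
    · obtain ⟨P', X, rfl, h4, -, -⟩ := small_eq_concat h1
      have hbc : b ≠ c := by
        rintro rfl
        exact List.disjoint_left.1 hnd'.2.2 (show b ∈ P' ++ b :: X by simp) (by simp)
      have := exists_translates_bac (P := P') (Y := Y) hg hr hc h2 (lt_of_le_of_ne h3 hbc) hck h4
        (by simpa using hw)
      simpa using this
    · obtain ⟨X, Y', rfl, h4, -, -⟩ := small_eq_cons h1
      have hab : a ≠ b := by
        rintro rfl
        exact hnd'.2.1.1 (by simp)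
      have := exists_translates_acb (P := P) (Y := Y') hg hr hc (lt_of_le_of_ne h2 hab) h3 hck h4
        (by simpa using hw)
      simpa using this

end

theorem AscentSwap.perm {w v : List ℕ} (h : AscentSwap w v) : w.Perm v := by
  obtain ⟨P, Y, a, c, -, rfl, rfl⟩ := h
  exact (List.Perm.refl P).append (List.Perm.swap ..)

theorem perm_of_insW_eq {w v : List ℕ} (h : insW w = insW v) : w.Perm v := by
  have h1 : tabW w = tabW v := by
    rw [tabW_eq_iff (tabW_ne_nil v), h, row_tabW]
  exact (tabW_perm w).symm.trans (h1 ▸ tabW_perm v)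

theorem WordStep.perm {w v : List ℕ} (h : WordStep w v) : w.Perm v :=
  h.elim AscentSwap.perm perm_of_insW_eq

/-- Translation of a chain of words whose small letters have a constant hook tableau. -/
theorem Translates.reflTransGen {k : ℕ} {r r' col col' w v w' v' : List ℕ}
    (hg : IsHookTableau k r' col') (hr : r.length = r'.length) (hc : col.length = col'.length)
    (h : Relation.ReflTransGen (fun w v => WordStep w v ∧ insW (small k w) = hk r col ∧
      insW (small k v) = hk r col) w v) (hnd : w.Nodup) (hw₀ : insW (small k w) = hk r col)
    (hw : Translates k (hk r' col') w w') (hv : Translates k (hk r' col') v v') :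
    Relation.ReflTransGen WordStep w' v' := by
  induction h using Relation.ReflTransGen.head_induction_on generalizing w' with
  | refl => exact .single (Or.inr (hw.insW_congr hv hw₀ hw₀ rfl))
  | head h _ ih =>
    obtain ⟨h1, h2, h3⟩ := h
    have hnd' := h1.perm.nodup_iff.1 hnd
    rcases h1 with h1 | h1
    · obtain ⟨x, y, hx, hy, hxy⟩ := exists_translates_ascentSwap hg hr hc h1 hnd h2 h3
      -- The given translation `w'` may differ from the word `x` supplied for this swap; both
      -- translate the same word, so a tableau-preserving step connects them.
      exact .head (Or.inr (hw.insW_congr hx h2 h2 rfl)) (hxy.trans (ih hnd' h3 hy))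
    · obtain ⟨y, hy⟩ := exists_translates hg (hookRows_hk r col) (hk_length_congr hr hc) h3
      exact .head (Or.inr (hw.insW_congr hy h2 h3 h1)) (ih hnd' h3 hy)

/-! ### Increasing subsequences -/

/-- This is Schensted's recursion: a longest weakly increasing subsequence with letters `≤ m` either
avoids the new letter `x`, or ends with it after a longest one with letters `≤ x`. -/
theorem countP_rowInsert {x : ℕ} (m : ℕ) {r : List ℕ} (hr : r.Pairwise (· ≤ ·)) :
    (rowInsert x r).1.countP (· ≤ m) =
      if x ≤ m then max (r.countP (· ≤ m)) (r.countP (· ≤ x) + 1) else r.countP (· ≤ m) := by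
  induction r with
  | nil =>
    split_ifs with h <;> simp [rowInsert, h]
  | cons e r ih =>
    rw [List.pairwise_cons] at hr
    rw [rowInsert]
    by_cases hx : x < e
    · rw [if_pos hx, List.countP_cons, List.countP_cons, List.countP_cons]
      have h1 : r.countP (· ≤ x) = 0 := by
        rw [List.countP_eq_zero]
        intro y hy
        have := hr.1 y hy
        simp only [decide_eq_true_eq]
        omega
      have h2 : ¬ e ≤ m → r.countP (· ≤ m) = 0 := by
        intro h
        rw [List.countP_eq_zero]
        intro y hy
        have := hr.1 y hy
        simp only [decide_eq_true_eq]
        omega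
      simp only [decide_eq_true_eq, h1]
      by_cases hm : x ≤ m <;> by_cases he : e ≤ m
      · simp [hm, he, hx.not_ge]
      · simp [hm, he, hx.not_ge, h2 he]
      · omega
      · simp [hm, he]
    · rw [if_neg hx]
      simp only [List.countP_cons, ih hr.2, decide_eq_true_eq]
      split_ifs <;> omega

theorem length_le_countP {w s : List ℕ} {m : ℕ} (hs : s.Sublist w) (h : s.Pairwise (· ≤ ·))
    (hm : ∀ x ∈ s, x ≤ m) : s.length ≤ (insW w 0).countP (· ≤ m) := by
  induction w using List.reverseRecOn generalizing s m with
  | nil => simp [List.sublist_nil.1 hs]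
  | append_singleton w x ih =>
    rw [insW_concat, insF, countP_rowInsert m (insW_sorted w 0)]
    obtain ⟨s₁, s₂, rfl, h1, h2⟩ := List.sublist_append_iff.1 hs
    rw [List.pairwise_append] at h
    rcases List.sublist_singleton.1 h2 with rfl | rfl
    · have := ih h1 h.1 fun y hy => hm y (by simp [hy])
      simp only [List.append_nil]
      split_ifs <;> omega
    · have := ih (m := x) h1 h.1 fun y hy => h.2.2 y hy x (by simp)
      rw [if_pos (hm x (by simp)), List.length_append, List.length_singleton]
      omega

theorem exists_increasing (w : List ℕ) (m : ℕ) : ∃ s : List ℕ, s.Sublist w ∧ s.Pairwise (· ≤ ·) ∧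
    (∀ x ∈ s, x ≤ m) ∧ s.length = (insW w 0).countP (· ≤ m) := by
  induction w using List.reverseRecOn generalizing m with
  | nil => exact ⟨[], by simp [insW, insL]⟩
  | append_singleton w x ih =>
    rw [insW_concat, insF, countP_rowInsert m (insW_sorted w 0)]
    obtain ⟨s, h1, h2, h3, h4⟩ := ih m
    -- The new letter is used only when the second term of the maximum is strictly larger.
    by_cases hc : x ≤ m ∧ (insW w 0).countP (· ≤ m) < (insW w 0).countP (· ≤ x) + 1
    · obtain ⟨s', h1', h2', h3', h4'⟩ := ih x
      refine ⟨s' ++ [x], h1'.append (.refl _), ?_, ?_, ?_⟩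
      · exact List.pairwise_append.2 ⟨h2', by simp, by simpa using h3'⟩
      · intro y hy
        rcases List.mem_append.1 hy with hy | hy
        · exact (h3' y hy).trans hc.1
        · obtain rfl : y = x := by simpa using hy
          exact hc.1
      · rw [if_pos hc.1, List.length_append, List.length_singleton, h4']
        omega
    · refine ⟨s, h1.trans (List.sublist_append_left ..), h2, h3, ?_⟩
      rw [h4]
      split_ifs with hx
      · rw [max_eq_left]
        by_contra hcon
        exact hc ⟨hx, not_le.1 hcon⟩
      · rfl

/-! ### Subsequences under an ascent swap -/

theorem sublist_pair {s : List ℕ} {a c : ℕ} (h : s.Sublist [a, c]) :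
    s = [a, c] ∨ s.Sublist [c, a] := by
  have : s ∈ [a, c].sublists := List.mem_sublists.2 h
  simp only [List.sublists_cons, List.sublists_nil] at this
  simp at this
  rcases this with rfl | rfl | rfl | rfl <;> simp

/-- Only a subsequence using both swapped letters can be lost. An ascent `a c` cannot occur in a
decreasing subsequence, nor a descent `c a` in an increasing one. -/
theorem exists_sublist_swap {P Y s : List ℕ} {a c : ℕ} (h : s.Sublist (P ++ a :: c :: Y))
    (hs : ¬ [a, c].Sublist s) : s.Sublist (P ++ c :: a :: Y) := by
  obtain ⟨s₁, t, rfl, h1, h2⟩ := List.sublist_append_iff.1 h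
  obtain ⟨s₂, s₃, rfl, h3, h4⟩ := (List.sublist_append_iff (r₁ := [a, c])).1 h2
  refine h1.append ((List.Sublist.append ?_ h4 : (s₂ ++ s₃).Sublist ([c, a] ++ Y)))
  rcases sublist_pair h3 with rfl | h5
  · refine absurd ?_ hs
    exact (List.sublist_append_left ..).trans (List.sublist_append_right ..)
  · exact h5

theorem WordStep.countP_le {w v : List ℕ} (h : WordStep w v) (m : ℕ) :
    (insW v 0).countP (· ≤ m) ≤ (insW w 0).countP (· ≤ m) := by
  rcases h with ⟨P, Y, a, c, hac, rfl, rfl⟩ | h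
  · obtain ⟨s, h1, h2, h3, h4⟩ := exists_increasing (P ++ c :: a :: Y) m
    rw [← h4]
    refine length_le_countP (exists_sublist_swap h1 fun h => ?_) h2 h3
    have := h2.sublist h
    simp at this
    omega
  · rw [h]

theorem eq_of_countP_eq {r r' : List ℕ} (hr : r.Pairwise (· ≤ ·)) (hr' : r'.Pairwise (· ≤ ·))
    (h : ∀ m, r.countP (· ≤ m) = r'.countP (· ≤ m)) : r = r' := by
  induction r generalizing r' with
  | nil =>
    cases r' with
    | nil => rfl
    | cons b r' => simpa using h b
  | cons a r ih =>
    cases r' with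
    | nil => simpa using h a
    | cons b r' =>
      rw [List.pairwise_cons] at hr hr'
      have key : ∀ {a b : ℕ} {r r' : List ℕ}, a < b → (∀ y ∈ r', b ≤ y) →
          (a :: r).countP (· ≤ a) ≠ (b :: r').countP (· ≤ a) := by
        intro a b r r' hab hb h
        have h0 : (b :: r').countP (· ≤ a) = 0 := by
          rw [List.countP_eq_zero]
          intro y hy
          simp only [decide_eq_true_eq, not_le]
          rcases List.mem_cons.1 hy with rfl | hy
          · exact hab
          · exact hab.trans_le (hb y hy)
        rw [h0] at h
        simp at h
      have hab : a = b := by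
        rcases lt_trichotomy a b with hab | hab | hab
        · exact absurd (h a) (key hab hr'.1)
        · exact hab
        · exact absurd (h b).symm (key hab hr.1)
      subst hab
      rw [ih hr.2 hr'.2 fun m => ?_]
      have := h m
      rw [List.countP_cons, List.countP_cons] at this
      omega

/-! ### Reading words and decreasing subsequences -/

/-- The row reading word, from the bottom row to the top row. -/
def readingWord : List (List ℕ) → List ℕ
  | [] => []
  | r :: t => readingWord t ++ r

theorem KnuthEquiv.move_left {x z : ℕ} (hxz : x < z) {l : List ℕ} (hl : l.Pairwise (· ≤ ·))
    (h : ∀ y ∈ l, y ≤ x) : KnuthEquiv (l ++ [z, x]) (z :: (l ++ [x])) := by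
  induction l with
  | nil => exact .refl _
  | cons e l ih =>
    rw [List.pairwise_cons] at hl
    refine ((ih hl.2 fun y hy => h y (by simp [hy])).cons e).trans ?_
    cases l with
    | nil => exact .acb (h e (by simp)) hxz []
    | cons f l => exact .acb (hl.1 f (by simp)) ((h f (by simp)).trans_lt hxz) _

/-- If `x` bumps `z`, then `x` travels left until it stands just after `z`, and `z` then travels to
the front of the row. -/
theorem knuthEquiv_rowInsert {r : List ℕ} (hr : r.Pairwise (· ≤ ·)) (x : ℕ) :
    KnuthEquiv (r ++ [x]) ((rowInsert x r).2.toList ++ (rowInsert x r).1) := by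
  rcases exists_split x r with h | ⟨l₁, z, l₂, rfl, h1, h2⟩
  · rw [rowInsert_of_le h]
    exact .refl _
  · rw [rowInsert_of_lt h1 h2]
    rw [List.pairwise_append] at hr
    have h3 := (KnuthEquiv.move_row h2 hr.2.1).congr l₁ []
    have h4 := (KnuthEquiv.move_left h2 hr.1 h1).congr [] l₂
    simp only [List.append_assoc, List.cons_append, List.nil_append, List.append_nil,
      Option.toList_some] at h3 h4 ⊢
    exact h3.trans h4

theorem knuthEquiv_tabInsert {t : List (List ℕ)} (ht : ∀ r ∈ t, r.Pairwise (· ≤ ·)) (x : ℕ) :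
    KnuthEquiv (readingWord t ++ [x]) (readingWord (tabInsert x t)) := by
  induction t generalizing x with
  | nil => exact .refl _
  | cons r t ih =>
    have h1 := (knuthEquiv_rowInsert (ht r (by simp)) x).congr (readingWord t) []
    rw [tabInsert]
    rcases h : rowInsert x r with ⟨r', _ | b⟩ <;> rw [h] at h1
    · simpa [readingWord] using h1
    · have h2 := (ih (fun q hq => ht q (by simp [hq])) b).congr [] r'
      simp only [readingWord, List.append_assoc, List.cons_append, List.nil_append, List.append_nil,
        Option.toList_some] at h1 h2 ⊢
      exact h1.trans h2

theorem tabW_sorted (w : List ℕ) : ∀ r ∈ tabW w, r.Pairwise (· ≤ ·) := by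
  intro r hr
  obtain ⟨i, hi, rfl⟩ := List.mem_iff_getElem.1 hr
  have := insW_sorted w i
  rw [← row_tabW] at this
  simpa [row, hi] using this

theorem knuthEquiv_readingWord (w : List ℕ) : KnuthEquiv w (readingWord (tabW w)) := by
  induction w using List.reverseRecOn with
  | nil => exact .refl _
  | append_singleton w x ih =>
    rw [tabW_concat]
    exact (ih.append (.refl [x])).trans (knuthEquiv_tabInsert (tabW_sorted w) x)

/-- Both words are Knuth equivalent to the reading word of their common tableau. -/
theorem knuthEquiv_of_insW_eq {w v : List ℕ} (h : insW w = insW v) : KnuthEquiv w v := by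
  have h1 : tabW w = tabW v := by
    rw [tabW_eq_iff (tabW_ne_nil v), h, row_tabW]
  have h2 := knuthEquiv_readingWord w
  rw [h1] at h2
  exact h2.trans (knuthEquiv_readingWord v).symm

/-- `w` has a strictly decreasing subsequence of length `m`. -/
def HasDecreasing (m : ℕ) (w : List ℕ) : Prop :=
  ∃ s : List ℕ, s.Sublist w ∧ s.Pairwise (· > ·) ∧ s.length = m

theorem mem_sublists_three {s : List ℕ} {x y z : ℕ} (h : s.Sublist [x, y, z]) :
    s = [] ∨ s = [x] ∨ s = [y] ∨ s = [x, y] ∨ s = [z] ∨ s = [x, z] ∨ s = [y, z] ∨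
      s = [x, y, z] := by
  have : s ∈ [x, y, z].sublists := List.mem_sublists.2 h
  simp only [List.sublists_cons, List.sublists_nil] at this
  simp at this
  tauto

/-- A replacement whose letters stay between letters of the replaced piece keeps the inequalities
with the parts on either side. -/
theorem HasDecreasing.replace {m : ℕ} {P Y l l' : List ℕ} (h : HasDecreasing m (P ++ l ++ Y))
    (hl : ∀ s : List ℕ, s.Sublist l → s.Pairwise (· > ·) → ∃ s' : List ℕ, s'.Sublist l' ∧
      s'.Pairwise (· > ·) ∧ s'.length = s.length ∧
      ∀ x ∈ s', (∃ y ∈ s, y ≤ x) ∧ ∃ y ∈ s, x ≤ y) : HasDecreasing m (P ++ l' ++ Y) := by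
  obtain ⟨s, h1, h2, rfl⟩ := h
  obtain ⟨t, s₃, rfl, h3, h4⟩ := List.sublist_append_iff.1 h1
  obtain ⟨s₁, s₂, rfl, h5, h6⟩ := List.sublist_append_iff.1 h3
  rw [List.pairwise_append, List.pairwise_append] at h2
  obtain ⟨s', h7, h8, h9, h10⟩ := hl s₂ h6 h2.1.2.1
  refine ⟨s₁ ++ s' ++ s₃, (h5.append h7).append h4, ?_, by simp [h9]⟩
  rw [List.pairwise_append, List.pairwise_append]
  refine ⟨⟨h2.1.1, h8, fun a ha b hb => ?_⟩, h2.2.1, fun a ha b hb => ?_⟩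
  · obtain ⟨y, hy, hby⟩ := (h10 b hb).2
    exact hby.trans_lt (h2.1.2.2 a ha y hy)
  · rcases List.mem_append.1 ha with ha | ha
    · exact h2.2.2 a (List.mem_append_left _ ha) b hb
    · obtain ⟨y, hy, hya⟩ := (h10 a ha).1
      exact (h2.2.2 y (List.mem_append_right _ hy) b hb).trans_le hya

theorem HasDecreasing.of_triple {m : ℕ} {P Y l l' : List ℕ} (h : KnuthTriple l l') :
    HasDecreasing m (P ++ l ++ Y) ↔ HasDecreasing m (P ++ l' ++ Y) := by
  have hself : ∀ s : List ℕ, ∀ x ∈ s, (∃ y ∈ s, y ≤ x) ∧ ∃ y ∈ s, x ≤ y :=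
    fun s x hx => ⟨⟨x, hx, le_rfl⟩, x, hx, le_rfl⟩
  cases h with
  | @bac a b c h1 h2 =>
    constructor <;> intro h <;> refine h.replace fun s hs hd => ?_
    · rcases mem_sublists_three hs with rfl | rfl | rfl | rfl | rfl | rfl | rfl | rfl
      on_goal 6 => exact absurd (by simpa using hd) h2.not_gt
      on_goal 6 => exact absurd (by simpa using hd) (h1.trans_le h2).not_gt
      on_goal 6 => exact absurd (List.pairwise_cons.1 hd).1 fun h => (h c (by simp)).not_ge h2
      all_goals exact ⟨_, by simp, hd, rfl, hself _⟩
    · rcases mem_sublists_three hs with rfl | rfl | rfl | rfl | rfl | rfl | rfl | rfl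
      on_goal 4 => exact absurd (by simpa using hd) h2.not_gt
      -- The only decreasing piece that is lost is `c a`; the witness `b` lies between these
      -- letters, and `b a` replaces it.
      on_goal 6 =>
        refine ⟨[b, a], by simp, by simpa using h1, rfl, ?_⟩
        simp [h2, h1.le]
      on_goal 6 => exact absurd (List.pairwise_cons.1 hd).1 fun h => (h c (by simp)).not_ge h2
      all_goals exact ⟨_, by simp, hd, rfl, hself _⟩
  | @acb a b c h1 h2 =>
    constructor <;> intro h <;> refine h.replace fun s hs hd => ?_
    · rcases mem_sublists_three hs with rfl | rfl | rfl | rfl | rfl | rfl | rfl | rfl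
      on_goal 4 => exact absurd (by simpa using hd) (h1.trans_lt h2).not_gt
      on_goal 5 => exact absurd (by simpa using hd) h1.not_gt
      on_goal 6 => exact absurd (List.pairwise_cons.1 hd).1 fun h => (h b (by simp)).not_ge h1
      all_goals exact ⟨_, by simp, hd, rfl, hself _⟩
    · rcases mem_sublists_three hs with rfl | rfl | rfl | rfl | rfl | rfl | rfl | rfl
      -- Again `c a` is lost, and here `c b` replaces it.
      on_goal 4 =>
        refine ⟨[c, b], by simp, by simpa using h2, rfl, ?_⟩
        simp [h1, h2.le]
      on_goal 6 => exact absurd (by simpa using hd) h1.not_gt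
      on_goal 6 =>
        exact absurd (List.pairwise_cons.1 (List.pairwise_cons.1 hd).2).1
          fun h => (h b (by simp)).not_ge h1
      all_goals exact ⟨_, by simp, hd, rfl, hself _⟩

theorem KnuthEquiv.hasDecreasing {m : ℕ} {w v : List ℕ} (h : KnuthEquiv w v) :
    HasDecreasing m w ↔ HasDecreasing m v := by
  induction h with
  | refl => rfl
  | symm _ ih => exact ih.symm
  | trans _ _ ih1 ih2 => exact ih1.trans ih2
  | triple P Y h => exact HasDecreasing.of_triple h

theorem WordStep.hasDecreasing {m : ℕ} {w v : List ℕ} (h : WordStep w v) (hw : HasDecreasing m w) :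
    HasDecreasing m v := by
  rcases h with ⟨P, Y, a, c, hac, rfl, rfl⟩ | h
  · obtain ⟨s, h1, h2, h3⟩ := hw
    refine ⟨s, exists_sublist_swap h1 fun h => ?_, h2, h3⟩
    have := h2.sublist h
    simp at this
    omega
  · exact (knuthEquiv_of_insW_eq h).hasDecreasing.1 hw

/-- A strictly decreasing subsequence takes at most one letter from each weakly increasing row. -/
theorem HasDecreasing.le_length {m : ℕ} {t : List (List ℕ)} (ht : ∀ r ∈ t, r.Pairwise (· ≤ ·))
    (h : HasDecreasing m (readingWord t)) : m ≤ t.length := by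
  induction t generalizing m with
  | nil =>
    obtain ⟨s, h1, -, rfl⟩ := h
    simp [List.sublist_nil.1 h1]
  | cons r t ih =>
    obtain ⟨s, h1, h2, rfl⟩ := h
    obtain ⟨s₁, s₂, rfl, h3, h4⟩ := List.sublist_append_iff.1 h1
    rw [List.pairwise_append] at h2
    have h5 := ih (fun q hq => ht q (by simp [hq])) ⟨s₁, h3, h2.1, rfl⟩
    have h6 : s₂.length ≤ 1 := by
      have h7 := (ht r (by simp)).sublist h4
      match s₂, h2.2.1, h7 with
      | [], _, _ => simp
      | [x], _, _ => simp
      | x :: y :: s, h8, h9 =>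
        exact absurd ((List.pairwise_cons.1 h8).1 y (by simp))
          ((List.pairwise_cons.1 h9).1 y (by simp)).not_gt
    simp only [List.length_append, List.length_cons]
    omega

/-- The first column, read upwards, is a decreasing subsequence of the reading word. -/
theorem hasDecreasing_hook {u r col : List ℕ} (h : insW u = hk r col) (hr : r ≠ []) :
    HasDecreasing (col.length + 1) u := by
  have h1 : tabW u = r :: col.map fun c => [c] := by
    rw [tabW_eq_iff (by simpa using hr), h, row_cons_singletons]
  have h2 := below_insW u
  rw [h] at h2
  obtain ⟨h3, h4⟩ := col_sorted_of_below h2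
  rw [(knuthEquiv_readingWord u).hasDecreasing, h1, readingWord]
  have h5 : ∀ c : List ℕ, readingWord (c.map fun c => [c]) = c.reverse := by
    intro c
    induction c with
    | nil => rfl
    | cons x c ih => simp [readingWord, ih]
  obtain ⟨a, ha, hac⟩ : ∃ a ∈ r, ∀ c ∈ col, a < c := by
    cases col with
    | nil => simpa using List.exists_mem_of_ne_nil r hr
    | cons c col =>
      obtain ⟨a, ha, hac⟩ := h4 c (by simp)
      refine ⟨a, ha, fun y hy => ?_⟩
      rcases List.mem_cons.1 hy with rfl | hy
      · exact hac
      · exact hac.trans ((List.pairwise_cons.1 h3).1 y hy)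
  rw [h5]
  refine ⟨col.reverse ++ [a], (List.Sublist.refl _).append (List.singleton_sublist.2 ha), ?_,
    by simp⟩
  rw [List.pairwise_append, List.pairwise_reverse]
  exact ⟨h3, by simp, by simpa using hac⟩

theorem length_eq_one_of_flatten {t : List (List ℕ)} (h : ∀ r ∈ t, r ≠ [])
    (hl : t.flatten.length ≤ t.length) : ∀ r ∈ t, r.length = 1 := by
  induction t with
  | nil => simp
  | cons r t ih =>
    have h1 : ∀ t : List (List ℕ), (∀ r ∈ t, r ≠ []) → t.length ≤ t.flatten.length := by
      intro t
      induction t with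
      | nil => simp
      | cons r t ih =>
        intro h
        have := ih fun q hq => h q (by simp [hq])
        have := List.length_pos_iff.2 (h r (by simp))
        simp only [List.flatten_cons, List.length_append, List.length_cons]
        omega
    have h2 := h1 t fun q hq => h q (by simp [hq])
    have h3 := List.length_pos_iff.2 (h r (by simp))
    simp only [List.flatten_cons, List.length_append, List.length_cons] at hl
    intro q hq
    rcases List.mem_cons.1 hq with rfl | hq
    · omega
    · exact ih (fun q hq => h q (by simp [hq])) (by omega) q hq

/-! ### Convexity of hook classes -/

theorem reflTransGen_perm {u v : List ℕ} (h : Relation.ReflTransGen WordStep u v) : u.Perm v := by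
  induction h with
  | refl => exact .refl _
  | tail _ h ih => exact ih.trans h.perm

theorem countP_le_of_reflTransGen {u v : List ℕ} (h : Relation.ReflTransGen WordStep u v) (m : ℕ) :
    (insW v 0).countP (· ≤ m) ≤ (insW u 0).countP (· ≤ m) := by
  induction h with
  | refl => exact le_rfl
  | tail _ h ih => exact (h.countP_le m).trans ih

/-- The entry counts of the first row are squeezed between equal values, so the first row of `v` is
`r`. The decreasing subsequence of `u` survives in `v` and bounds the number of rows from below. -/
theorem insW_eq_of_between {u v u' r col : List ℕ} (h : Relation.ReflTransGen WordStep u v)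
    (h' : Relation.ReflTransGen WordStep v u') (hu : insW u = hk r col) (hu' : insW u' = hk r col)
    (hr : r ≠ []) : insW v = hk r col := by
  have hrow : insW v 0 = r := by
    refine eq_of_countP_eq (insW_sorted v 0) ?_ fun m => ?_
    · have := insW_sorted u 0
      rwa [hu] at this
    · have h1 := countP_le_of_reflTransGen h m
      have h2 := countP_le_of_reflTransGen h' m
      rw [hu] at h1
      rw [hu'] at h2
      exact le_antisymm h1 h2
  have hdec : HasDecreasing (col.length + 1) v := by
    have h1 := hasDecreasing_hook hu hr
    clear h' hrow
    induction h with
    | refl => exact h1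
    | tail _ h ih => exact h.hasDecreasing ih
  rw [(knuthEquiv_readingWord v).hasDecreasing] at hdec
  have hlen := hdec.le_length (tabW_sorted v)
  have hperm := tabW_perm v
  have hne := tabW_ne_nil v
  have hp : (r ++ col).Perm v := (perm_of_insW_eq_hk hu).trans (reflTransGen_perm h)
  rcases ht : tabW v with _ | ⟨r', t⟩
  · rw [ht] at hlen
    simp at hlen
  · rw [ht] at hlen hperm hne
    obtain rfl : r' = r := by
      rw [← row_tabW, ht] at hrow
      exact hrow
    have hl := (hp.trans hperm.symm).length_eq
    simp only [List.flatten_cons, List.length_append, List.length_cons] at hl hlen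
    -- Below the first row there are exactly `col.length` cells in at least `col.length` nonempty
    -- rows, so each of these rows has one cell.
    obtain ⟨col', rfl⟩ := exists_singletons
      (length_eq_one_of_flatten (t := t) (fun q hq => hne q (by simp [hq])) (by omega))
    have hv : insW v = hk r' col' := by rw [← row_tabW, ht, row_cons_singletons]
    have hb := below_insW v
    have hb' := below_insW u
    rw [hv] at hb
    rw [hu] at hb'
    have hc : col'.Perm col :=
      (List.perm_append_left_iff r').1 ((perm_of_insW_eq_hk hv).trans hp.symm)
    rw [hv, hc.eq_of_pairwise (fun a b _ _ h h' => (lt_asymm h h').elim)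
      (col_sorted_of_below hb).1 (col_sorted_of_below hb').1]

/-- A swap involving a large letter disappears when large letters are deleted. A tableau-preserving
step stays one, because the tableau of the small letters is cut out of the full tableau. -/
theorem WordStep.small {w v : List ℕ} (h : WordStep w v) (k : ℕ) :
    WordStep (small k w) (TableauOrder.small k v) := by
  rcases h with ⟨P, Y, a, c, hac, rfl, rfl⟩ | h
  · rw [small_append, small_append]
    rcases le_or_gt c k with hc | hc
    · have ha : a ≤ k := by omega
      rw [small_cons_of_le ha, small_cons_of_le hc, small_cons_of_le hc, small_cons_of_le ha]
      exact Or.inl ⟨_, _, a, c, hac, rfl, rfl⟩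
    · right
      rcases le_or_gt a k with ha | ha
      · rw [small_cons_of_le ha, small_cons_of_lt hc, small_cons_of_lt hc, small_cons_of_le ha]
      · rw [small_cons_of_lt ha, small_cons_of_lt hc, small_cons_of_lt hc, small_cons_of_lt ha]
  · right
    funext i
    rw [← filter_insW, ← filter_insW, h]

theorem reflTransGen_small {w v : List ℕ} (h : Relation.ReflTransGen WordStep w v) (k : ℕ) :
    Relation.ReflTransGen WordStep (small k w) (small k v) :=
  h.lift (small k) fun _ _ h => h.small k

/-- In a chain of words, if the small letters of the ends have the same hook tableau, then this is
the tableau of the small letters of each word of the chain. -/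
theorem reflTransGen_constant {k : ℕ} {w v r col : List ℕ} (h : Relation.ReflTransGen WordStep w v)
    (hw : insW (small k w) = hk r col) (hv : insW (small k v) = hk r col) (hr : r ≠ []) :
    Relation.ReflTransGen (fun w v => WordStep w v ∧ insW (small k w) = hk r col ∧
      insW (small k v) = hk r col) w v := by
  induction h using Relation.ReflTransGen.head_induction_on with
  | refl => exact .refl
  | @head x y h1 h2 ih =>
    have hy := insW_eq_of_between (.single (h1.small k)) (reflTransGen_small h2 k) hw hv hr
    exact .head ⟨h1, hw, hy⟩ (ih hy)

/-! ### Permutations and words -/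

/-- The number of inversions of a word. -/
def inversions : List ℕ → ℕ
  | [] => 0
  | x :: l => l.countP (· < x) + inversions l

theorem inversions_swap {a c : ℕ} (h : a < c) (P Y : List ℕ) :
    inversions (P ++ c :: a :: Y) = inversions (P ++ a :: c :: Y) + 1 := by
  induction P with
  | nil =>
    simp only [List.nil_append, inversions, List.countP_cons, decide_eq_true_eq, if_pos h,
      if_neg h.not_gt]
    omega
  | cons x P ih =>
    have hp : (P ++ c :: a :: Y).Perm (P ++ a :: c :: Y) :=
      (List.Perm.refl P).append (List.Perm.swap ..)
    simp only [List.cons_append, inversions, ih, hp.countP_eq]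
    omega

theorem AscentSwap.inversions_eq {w v : List ℕ} (h : AscentSwap w v) :
    inversions v = inversions w + 1 := by
  obtain ⟨P, Y, a, c, h, rfl, rfl⟩ := h
  exact inversions_swap h P Y

theorem inversions_eq_zero {l : List ℕ} (h : l.Pairwise (· ≤ ·)) : inversions l = 0 := by
  induction l with
  | nil => rfl
  | cons x l ih =>
    rw [List.pairwise_cons] at h
    rw [inversions, ih h.2, List.countP_eq_zero.2]
    simpa using h.1

theorem exists_descent {w : List ℕ} (h : ¬ w.Pairwise (· ≤ ·)) : ∃ v, AscentSwap v w := by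
  induction w with
  | nil => simp at h
  | cons x w ih =>
    by_cases hw : w.Pairwise (· ≤ ·)
    · cases w with
      | nil => simp at h
      | cons y w =>
        refine ⟨y :: x :: w, [], w, y, x, ?_, rfl, rfl⟩
        by_contra hxy
        refine h (List.pairwise_cons.2 ⟨fun z hz => ?_, hw⟩)
        rcases List.mem_cons.1 hz with rfl | hz
        · exact not_lt.1 hxy
        · exact (not_lt.1 hxy).trans ((List.pairwise_cons.1 hw).1 z hz)
    · obtain ⟨v, P, Y, a, c, h1, rfl, rfl⟩ := ih hw
      exact ⟨_, x :: P, Y, a, c, h1, rfl, rfl⟩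

section

variable {n : ℕ}

theorem length_word (w : Equiv.Perm (Fin n)) : (word w).length = n := by simp [word]

theorem getElem_word (w : Equiv.Perm (Fin n)) {i : ℕ} (h : i < (word w).length) :
    (word w)[i] = (w ⟨i, by simpa [word] using h⟩ : ℕ) + 1 := by simp [word]

theorem word_injective : Function.Injective (word (n := n)) := by
  intro u v h
  ext i
  have h1 : ∀ (w : Equiv.Perm (Fin n)), (word w)[(i : ℕ)]? = some ((w i : ℕ) + 1) := by
    intro w
    simp [word]
  have h2 := h1 u
  rw [h, h1 v] at h2
  simpa using h2.symm

theorem word_perm (w : Equiv.Perm (Fin n)) : (word w).Perm (List.range' 1 n) := by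
  refine (List.perm_ext_iff_of_nodup ?_ List.nodup_range').2 fun m => ?_
  · refine List.nodup_ofFn.2 fun i j h => ?_
    exact w.injective (Fin.ext (by simpa using h))
  · rw [List.mem_range'_1]
    constructor
    · intro h
      obtain ⟨i, rfl⟩ := (List.mem_ofFn' ..).1 h
      have := (w i).2
      simp only
      omega
    · intro h
      refine (List.mem_ofFn' ..).2 ⟨w.symm ⟨m - 1, by omega⟩, ?_⟩
      simp only [Equiv.apply_symm_apply]
      omega

theorem word_nodup (w : Equiv.Perm (Fin n)) : (word w).Nodup :=
  (word_perm w).nodup_iff.2 List.nodup_range'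

theorem exists_word {l : List ℕ} (h : l.Perm (List.range' 1 n)) :
    ∃ w : Equiv.Perm (Fin n), word w = l := by
  have hl : l.length = n := by simpa using h.length_eq
  have hm : ∀ i (hi : i < l.length), 1 ≤ l[i] ∧ l[i] < 1 + n := fun i hi =>
    List.mem_range'_1.1 (h.mem_iff.1 (List.getElem_mem hi))
  have hnd : l.Nodup := h.nodup_iff.2 List.nodup_range'
  let f : Fin n → Fin n := fun i =>
    ⟨l[(i : ℕ)]'(by have := i.2; omega) - 1, by have := hm i (by have := i.2; omega); omega⟩
  have hf : Function.Injective f := by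
    intro i j hij
    have h1 := hm i (by have := i.2; omega)
    have h2 := hm j (by have := j.2; omega)
    have h3 : l[(i : ℕ)]'(by have := i.2; omega) - 1 = l[(j : ℕ)]'(by have := j.2; omega) - 1 :=
      congrArg Fin.val hij
    exact Fin.ext ((hnd.getElem_inj_iff).1 (show l[(i : ℕ)]'_ = l[(j : ℕ)]'_ by omega))
  refine ⟨Equiv.ofBijective f (Finite.injective_iff_bijective.1 hf), ?_⟩
  refine List.ext_getElem (by rw [length_word, hl]) fun i h1 h2 => ?_
  rw [getElem_word]
  change l[i] - 1 + 1 = l[i]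
  have := hm i h2
  omega

/-- Multiplication on the right acts on positions, so the right weak order swaps adjacent letters of
the word. -/
theorem word_mul_swap (u : Equiv.Perm (Fin n)) {i : ℕ} (h : i + 1 < n) :
    ∃ P Y x y, P.length = i ∧ word u = P ++ x :: y :: Y ∧
      word (u * Equiv.swap ⟨i, Nat.lt_of_succ_lt h⟩ ⟨i + 1, h⟩) = P ++ y :: x :: Y := by
  have hl := length_word u
  have e : word u = (word u).take i ++
      (word u)[i]'(by omega) :: (word u)[i + 1]'(by omega) :: (word u).drop (i + 2) := by
    rw [← List.drop_eq_getElem_cons, ← List.drop_eq_getElem_cons, List.take_append_drop]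
  refine ⟨(word u).take i, (word u).drop (i + 2), (word u)[i]'(by omega),
    (word u)[i + 1]'(by omega), by simp; omega, e, ?_⟩
  refine List.ext_getElem (by simp [length_word]; omega) fun j h1 h2 => ?_
  rw [length_word] at h1
  rw [getElem_word, Equiv.Perm.mul_apply]
  have hlen : ((word u).take i).length = i := by simp; omega
  rcases lt_trichotomy j i with hj | rfl | hj
  · rw [Equiv.swap_apply_of_ne_of_ne (by simp; omega) (by simp; omega),
      List.getElem_append_left (by omega), List.getElem_take, getElem_word]
  · rw [Equiv.swap_apply_left, List.getElem_append_right (by omega)]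
    simp only [hlen, Nat.sub_self, List.getElem_cons_zero, getElem_word]
  · rcases Nat.eq_or_lt_of_le hj with rfl | hj'
    · rw [Equiv.swap_apply_right, List.getElem_append_right (by omega)]
      simp only [hlen, Nat.succ_eq_add_one, Nat.add_sub_cancel_left, List.getElem_cons_succ,
        List.getElem_cons_zero, getElem_word]
    · rw [Equiv.swap_apply_of_ne_of_ne (by simp; omega) (by simp; omega),
        List.getElem_append_right (by omega)]
      obtain ⟨d, rfl⟩ : ∃ d, j = i + 2 + d := ⟨j - (i + 2), by omega⟩
      have e2 : i + 2 + d - ((word u).take i).length = d + 1 + 1 := by omega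
      simp only [e2, List.getElem_cons_succ, List.getElem_drop, getElem_word]

theorem ascentSwap_or (u : Equiv.Perm (Fin n)) {s : Equiv.Perm (Fin n)} (hs : IsAdjacentSwap s) :
    AscentSwap (word u) (word (u * s)) ∨ AscentSwap (word (u * s)) (word u) := by
  obtain ⟨i, h, rfl⟩ := hs
  obtain ⟨P, Y, x, y, -, h1, h2⟩ := word_mul_swap u h
  have hnd := word_nodup u
  rw [h1, List.nodup_append', List.nodup_cons] at hnd
  have hxy : x ≠ y := by
    rintro rfl
    exact hnd.2.1.1 (by simp)
  rw [h1, h2]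
  rcases lt_or_gt_of_ne hxy with hxy | hxy
  · exact Or.inl ⟨P, Y, x, y, hxy, rfl, rfl⟩
  · exact Or.inr ⟨P, Y, y, x, hxy, rfl, rfl⟩

theorem exists_adjacentSwap {u v : Equiv.Perm (Fin n)} (h : AscentSwap (word u) (word v)) :
    ∃ s, IsAdjacentSwap s ∧ v = u * s := by
  obtain ⟨P, Y, a, c, -, h1, h2⟩ := h
  have hi : P.length + 1 < n := by
    have := length_word u
    rw [h1] at this
    simp at this
    omega
  refine ⟨_, ⟨P.length, hi, rfl⟩, word_injective ?_⟩
  obtain ⟨P', Y', x, y, h3, h4, h5⟩ := word_mul_swap u hi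
  rw [h1] at h4
  obtain ⟨rfl, h6⟩ := List.append_inj h4 h3.symm
  simp only [List.cons.injEq] at h6
  obtain ⟨rfl, rfl, rfl⟩ := h6
  rw [h5, h2]

theorem word_one_sorted : (word (1 : Equiv.Perm (Fin n))).Pairwise (· ≤ ·) := by
  refine List.pairwise_iff_getElem.2 fun i j hi hj hij => ?_
  rw [getElem_word, getElem_word]
  simp only [Equiv.Perm.coe_one, id_eq]
  omega

theorem word_sorted_eq {w : Equiv.Perm (Fin n)} (h : (word w).Pairwise (· ≤ ·)) : w = 1 := by
  refine word_injective (((word_perm w).trans (word_perm 1).symm).eq_of_pairwise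
    (fun a b _ _ h h' => le_antisymm h h') h word_one_sorted)

theorem exists_reduced (w : Equiv.Perm (Fin n)) : ∃ l : List (Equiv.Perm (Fin n)),
    (∀ s ∈ l, IsAdjacentSwap s) ∧ l.prod = w ∧ l.length = inversions (word w) := by
  induction hm : inversions (word w) generalizing w with
  | zero =>
    have h : (word w).Pairwise (· ≤ ·) := by
      by_contra h
      obtain ⟨v, hv⟩ := exists_descent h
      have := hv.inversions_eq
      omega
    exact ⟨[], by simp, by simp [word_sorted_eq h], rfl⟩
  | succ m ih =>
    have h : ¬ (word w).Pairwise (· ≤ ·) := by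
      intro h
      rw [inversions_eq_zero h] at hm
      omega
    obtain ⟨v, hv⟩ := exists_descent h
    obtain ⟨u, rfl⟩ := exists_word (hv.perm.trans (word_perm w))
    obtain ⟨s, hs, rfl⟩ := exists_adjacentSwap hv
    obtain ⟨l, h1, h2, h3⟩ := ih u (by have := hv.inversions_eq; omega)
    refine ⟨l ++ [s], ?_, by simp [h2], by simp [h3]⟩
    intro t ht
    rcases List.mem_append.1 ht with ht | ht
    · exact h1 t ht
    · obtain rfl : t = s := by simpa using ht
      exact hs

theorem inversions_prod_le (l : List (Equiv.Perm (Fin n))) (h : ∀ s ∈ l, IsAdjacentSwap s) :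
    inversions (word l.prod) ≤ l.length := by
  induction l using List.reverseRecOn with
  | nil =>
    rw [List.prod_nil, inversions_eq_zero word_one_sorted]
    exact Nat.zero_le _
  | append_singleton l s ih =>
    have h1 := ih fun t ht => h t (by simp [ht])
    rw [List.prod_append, List.prod_singleton, List.length_append, List.length_singleton]
    rcases ascentSwap_or l.prod (h s (by simp)) with h2 | h2
    · have := h2.inversions_eq
      omega
    · have := h2.inversions_eq
      omega

/-- An adjacent swap changes the number of inversions by one, which bounds the length of every
expression from below; undoing descents one at a time gives an expression attaining the bound. -/
theorem permLength_eq (w : Equiv.Perm (Fin n)) : permLength w = inversions (word w) := by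
  refine le_antisymm (Nat.sInf_le (exists_reduced w)) ?_
  refine le_csInf ⟨_, exists_reduced w⟩ ?_
  rintro m ⟨l, h1, rfl, rfl⟩
  exact inversions_prod_le l h1

theorem permWeakStep_iff {u w : Equiv.Perm (Fin n)} :
    PermWeakStep u w ↔ AscentSwap (word u) (word w) := by
  constructor
  · rintro ⟨s, hs, rfl, hl⟩
    rw [permLength_eq, permLength_eq] at hl
    rcases ascentSwap_or u hs with h | h
    · exact h
    · have := h.inversions_eq
      omega
  · intro h
    obtain ⟨s, hs, rfl⟩ := exists_adjacentSwap h
    exact ⟨s, hs, rfl, by rw [permLength_eq, permLength_eq, h.inversions_eq]⟩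

end

/-! ### Standard Young tableaux and their rows -/

section

variable {n k : ℕ}

theorem SYT.row_rows (T : SYT n) (i : ℕ) :
    row T.rows i = (List.range (T.shape.rowLen i)).map (T.entry i) := by
  by_cases h : i < T.shape.colLen 0
  · simp [row, SYT.rows, h]
  · have h0 : T.shape.rowLen i = 0 := by
      by_contra h0
      exact h (YoungDiagram.mem_iff_lt_colLen.1 (YoungDiagram.mem_iff_lt_rowLen.2
        (Nat.pos_of_ne_zero h0)))
    simp [row, SYT.rows, h, h0]

theorem SYT.rows_ne_nil (T : SYT n) : ∀ r ∈ T.rows, r ≠ [] := by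
  intro r hr
  obtain ⟨i, hi, rfl⟩ := List.mem_map.1 hr
  rw [List.mem_range] at hi
  have := YoungDiagram.mem_iff_lt_rowLen.1 (YoungDiagram.mem_iff_lt_colLen.2 hi)
  simp
  omega

theorem mem_knuthClass {T : SYT n} {w : Equiv.Perm (Fin n)} :
    w ∈ knuthClass T ↔ insW (word w) = row T.rows :=
  tabW_eq_iff T.rows_ne_nil

theorem SYT.mem_row {T : SYT n} {m : ℕ} : (∃ i, m ∈ row T.rows i) ↔ 1 ≤ m ∧ m ≤ n := by
  constructor
  · rintro ⟨i, h⟩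
    rw [T.row_rows, List.mem_map] at h
    obtain ⟨j, hj, rfl⟩ := h
    have := YoungDiagram.mem_iff_lt_rowLen.2 (List.mem_range.1 hj)
    exact ⟨T.entry_pos this, T.entry_le this⟩
  · intro h
    obtain ⟨c, hc, rfl⟩ := T.bijOn.surjOn (show m ∈ Set.Icc 1 n from h)
    refine ⟨c.1, ?_⟩
    rw [T.row_rows]
    exact List.mem_map.2 ⟨c.2, List.mem_range.2 (YoungDiagram.mem_iff_lt_rowLen.1 hc), rfl⟩

/-- A word of length `n` whose insertion tableau is a standard Young tableau is a permutation. -/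
theorem SYT.exists_word_eq {T : SYT n} {x : List ℕ} (hl : x.length = n)
    (h : insW x = row T.rows) : ∃ w : Equiv.Perm (Fin n), word w = x := by
  refine exists_word (List.Subperm.perm_of_length_le ?_ ?_).symm
  · refine List.subperm_of_subset List.nodup_range' fun m hm => ?_
    rw [List.mem_range'_1] at hm
    obtain ⟨i, hi⟩ := (SYT.mem_row (T := T)).2 ⟨hm.1, by omega⟩
    rw [← h] at hi
    exact mem_insW hi
  · simp [hl]

/-- The rows of the insertion tableau of a word are those of a tableau. -/
theorem exists_mem_knuthClass (w : Equiv.Perm (Fin n)) : ∃ T : SYT n, w ∈ knuthClass T := by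
  set t := tabW (word w) with ht
  have hrow : row t = insW (word w) := row_tabW _
  have hperm : t.flatten.Perm (List.range' 1 n) := (tabW_perm _).trans (word_perm w)
  have hnd : t.flatten.Nodup := hperm.nodup_iff.2 List.nodup_range'
  rw [List.nodup_flatten] at hnd
  have hget : ∀ {i}, (h : i < t.length) → row t i = t[i] := fun h => by simp [row, h]
  have hlen : ∀ {i j}, j < (row t i).length → i < t.length := by
    intro i j h
    by_contra hi
    simp [row, hi] at h
  have hanti : Antitone fun i => (row t i).length :=
    -- The rows get weakly shorter because each can be placed below the previous one; this makes the
    -- set of cells a Young diagram.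
    antitone_nat_of_succ_le fun i => by
      rw [hrow]
      exact (below_insW _ i).length_le
  have hstrict : ∀ {i j₁ j₂} (_ : j₁ < j₂) (h₂ : j₂ < (row t i).length),
      (row t i).getD j₁ 0 < (row t i).getD j₂ 0 := by
    intro i j₁ j₂ hj h₂
    have h₁ : j₁ < (row t i).length := hj.trans h₂
    have hs : (row t i).Pairwise (· ≤ ·) := by rw [hrow]; exact insW_sorted _ i
    have hn : (row t i).Nodup := by
      rw [hget (hlen h₂)]
      exact hnd.1 _ (List.getElem_mem _)
    simp only [List.getD_eq_getElem?_getD, List.getElem?_eq_getElem h₁,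
      List.getElem?_eq_getElem h₂, Option.getD_some]
    refine lt_of_le_of_ne (List.pairwise_iff_getElem.1 hs _ _ h₁ h₂ hj) fun h => ?_
    exact hj.ne (hn.getElem_inj_iff.1 h)
  have hcol : ∀ {i j} (_ : j < (row t (i + 1)).length),
      (row t i).getD j 0 < (row t (i + 1)).getD j 0 := by
    intro i j h
    have hb : Below (row t i) (row t (i + 1)) := by rw [hrow]; exact below_insW _ i
    have h' := h.trans_le hb.length_le
    simp only [List.getD_eq_getElem?_getD, List.getElem?_eq_getElem h,
      List.getElem?_eq_getElem h', Option.getD_some]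
    exact hb.getElem_lt h
  let μ : YoungDiagram :=
    { cells := (Finset.range t.length).sigma (fun i => Finset.range (row t i).length) |>.map
        (Equiv.sigmaEquivProd ℕ ℕ).toEmbedding
      isLowerSet := by
        rintro ⟨i, j⟩ ⟨i', j'⟩ ⟨hi, hj⟩ h
        simp only [Finset.coe_map, Set.mem_image, Finset.mem_coe, Finset.mem_sigma,
          Finset.mem_range, Equiv.coe_toEmbedding, Sigma.exists, Equiv.sigmaEquivProd_apply,
          Prod.mk.injEq] at h ⊢
        obtain ⟨i, j, ⟨h1, h2⟩, rfl, rfl⟩ := h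
        exact ⟨i', j', ⟨hi.trans_lt h1, hj.trans_lt (h2.trans_le (hanti hi))⟩, rfl, rfl⟩ }
  have hμ : ∀ {i j}, (i, j) ∈ μ ↔ j < (row t i).length := by
    intro i j
    rw [← YoungDiagram.mem_cells]
    simp only [μ, Finset.mem_map, Finset.mem_sigma, Finset.mem_range, Equiv.coe_toEmbedding,
      Sigma.exists, Equiv.sigmaEquivProd_apply, Prod.mk.injEq]
    constructor
    · rintro ⟨i, j, ⟨h1, h2⟩, rfl, rfl⟩
      exact h2
    · intro h
      exact ⟨i, j, ⟨hlen h, h⟩, rfl, rfl⟩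
  have hmem : ∀ {i j}, (i, j) ∈ μ → (row t i).getD j 0 ∈ row t i := by
    intro i j h
    rw [hμ] at h
    simp [List.getD_eq_getElem?_getD, List.getElem?_eq_getElem h]
  let T : SYT n :=
    { shape := μ
      entry := fun i j => (row t i).getD j 0
      row_strict := fun hj h => hstrict hj (hμ.1 h)
      col_strict := by
        intro i₁ i₂ j hi h
        induction i₂, hi using Nat.le_induction with
        | base => exact hcol (hμ.1 h)
        | succ i₂ hi ih =>
          exact (ih (μ.up_left_mem (Nat.le_succ _) le_rfl h)).trans (hcol (hμ.1 h))
      zeros := by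
        intro i j h
        rw [hμ] at h
        simp [List.getD_eq_getElem?_getD, List.getElem?_eq_none (not_lt.1 h)]
      bijOn := by
        refine ⟨?_, ?_, ?_⟩
        · rintro ⟨i, j⟩ h
          have h1 := hmem h
          rw [hrow] at h1
          have h2 := List.mem_range'_1.1 ((word_perm w).mem_iff.1 (mem_insW h1))
          rw [← hrow] at h2
          refine ⟨h2.1, ?_⟩
          have := h2.2
          simp only
          omega
        · rintro ⟨i, j⟩ h ⟨i', j'⟩ h' he
          simp only at he
          have hm := hmem h
          have hm' := hmem h'
          have hj := hμ.1 h
          have hj' := hμ.1 h'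
          have hi := hlen hj
          have hi' := hlen hj'
          have key : ∀ {a b} (ha : a < t.length) (hb : b < t.length), a < b →
              ∀ y ∈ row t a, y ∉ row t b := by
            intro a b ha hb hab y hy hy'
            rw [hget ha] at hy
            rw [hget hb] at hy'
            exact List.disjoint_left.1 (List.pairwise_iff_getElem.1 hnd.2 a b ha hb hab) hy hy'
          rcases lt_trichotomy i i' with hii | rfl | hii
          · exact absurd (he ▸ hm') (key hi hi' hii _ hm)
          · rcases lt_trichotomy j j' with hjj | rfl | hjj
            · exact absurd he (hstrict hjj hj').ne
            · rfl
            · exact absurd he (hstrict hjj hj).ne'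
          · exact absurd (he ▸ hm) (key hi' hi hii _ hm')
        · intro m hm
          have h1 : m ∈ t.flatten := hperm.mem_iff.2 (List.mem_range'_1.2 ⟨hm.1, by
            have := hm.2
            omega⟩)
          obtain ⟨r, hr, hmr⟩ := List.mem_flatten.1 h1
          obtain ⟨i, hi, rfl⟩ := List.mem_iff_getElem.1 hr
          obtain ⟨j, hj, rfl⟩ := List.mem_iff_getElem.1 hmr
          rw [← hget hi] at hj
          refine ⟨(i, j), hμ.2 hj, ?_⟩
          simp [row, hi, List.getD_eq_getElem?_getD, hget hi ▸ hj] }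
  refine ⟨T, mem_knuthClass.2 ?_⟩
  rw [← hrow]
  funext i
  rw [T.row_rows]
  have hrl : T.shape.rowLen i = (row t i).length := by
    refine le_antisymm (not_lt.1 fun h => ?_) (not_lt.1 fun h => ?_)
    · exact lt_irrefl _ (hμ.1 (YoungDiagram.mem_iff_lt_rowLen.2 h))
    · exact lt_irrefl _ (YoungDiagram.mem_iff_lt_rowLen.1 (hμ.2 h))
  refine List.ext_getElem (by simp [hrl]) fun j h1 h2 => ?_
  simp [T, List.getD_eq_getElem?_getD, h1]

/-! ### The weak order in terms of words -/

theorem le_of_reflTransGen {S T : SYT n} {σ τ : Equiv.Perm (Fin n)} (hσ : σ ∈ knuthClass S)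
    (hτ : τ ∈ knuthClass T) (h : Relation.ReflTransGen WordStep (word σ) (word τ)) : S ≤ T := by
  generalize hw : word σ = w at h
  induction h using Relation.ReflTransGen.head_induction_on generalizing S σ with
  | refl =>
    obtain rfl := word_injective hw
    exact Relation.ReflTransGen.single ⟨σ, hσ, σ, hτ, .refl⟩
  | head h _ ih =>
    subst hw
    obtain ⟨ω, rfl⟩ := exists_word (h.perm.symm.trans (word_perm σ))
    rcases h with h | h
    · obtain ⟨U, hU⟩ := exists_mem_knuthClass ω
      have h1 : S ≤ U := Relation.ReflTransGen.single
        ⟨σ, hσ, ω, hU, Relation.ReflTransGen.single (permWeakStep_iff.2 h)⟩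
      exact h1.trans (ih hU rfl)
    · exact ih (mem_knuthClass.2 (h ▸ mem_knuthClass.1 hσ)) rfl

/-- Consecutive relations are glued inside the Knuth class of the middle tableau by a
tableau-preserving step. The alternative `S = T` covers the reflexive case without choosing a word
in the class. -/
theorem reflTransGen_of_le {S T : SYT n} (h : S ≤ T) :
    S = T ∨ ∃ σ ∈ knuthClass S, ∃ τ ∈ knuthClass T,
      Relation.ReflTransGen WordStep (word σ) (word τ) := by
  change Relation.ReflTransGen TabWeakStep S T at h
  have key : ∀ {σ τ : Equiv.Perm (Fin n)}, PermWeakLE σ τ →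
      Relation.ReflTransGen WordStep (word σ) (word τ) := fun {σ τ} h =>
    (show Relation.ReflTransGen PermWeakStep σ τ from h).lift word
      fun _ _ h => Or.inl (permWeakStep_iff.1 h)
  induction h with
  | refl => exact Or.inl rfl
  | tail _ h ih =>
    obtain ⟨σ', hσ', τ', hτ', h'⟩ := h
    right
    rcases ih with rfl | ⟨σ, hσ, τ, hτ, h1⟩
    · exact ⟨σ', hσ', τ', hτ', key h'⟩
    · exact ⟨σ, hσ, τ', hτ',
        (h1.tail (Or.inr ((mem_knuthClass.1 hτ).trans (mem_knuthClass.1 hσ').symm))).trans (key h')⟩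

/-! ### Inner tableaux -/

/-- The part of the rows of `T` outside of its inner tableau. -/
def outerRows {hk : k ≤ n} {R : SYT k} (T : SYTWithInner hk R) (i : ℕ) : List ℕ :=
  (List.range' (R.shape.rowLen i) (T.1.shape.rowLen i - R.shape.rowLen i)).map (T.1.entry i)

theorem SYTWithInner.entry_eq {hk : k ≤ n} {R : SYT k} (T : SYTWithInner hk R) {i j : ℕ}
    (h : (i, j) ∈ R.shape) : T.1.entry i j = R.entry i j := by
  obtain ⟨T, rfl⟩ := T
  exact (if_pos h).symm

theorem SYTWithInner.rowLen_le {hk : k ≤ n} {R : SYT k} (T : SYTWithInner hk R) (i : ℕ) :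
    R.shape.rowLen i ≤ T.1.shape.rowLen i := by
  by_contra h
  exact lt_irrefl _ (YoungDiagram.mem_iff_lt_rowLen.1
    (T.mem_iff.1 (YoungDiagram.mem_iff_lt_rowLen.2 (not_le.1 h))).1)

theorem SYTWithInner.row_rows {hk : k ≤ n} {R : SYT k} (T : SYTWithInner hk R) :
    row T.1.rows = glue (row R.rows) (outerRows T) := by
  funext i
  rw [glue, T.1.row_rows, R.row_rows, outerRows]
  obtain ⟨d, hd⟩ := Nat.exists_eq_add_of_le (T.rowLen_le i)
  rw [hd, Nat.add_sub_cancel_left, List.range_eq_range', List.range_eq_range',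
    show List.range' 0 (R.shape.rowLen i + d)
      = List.range' 0 (R.shape.rowLen i) ++ List.range' (R.shape.rowLen i) d by
        rw [← List.range'_append]; simp,
    List.map_append]
  congr 1
  refine List.map_congr_left fun j hj => T.entry_eq ?_
  rw [YoungDiagram.mem_iff_lt_rowLen]
  simpa using hj

theorem SYTWithInner.outerRows_gt {hk : k ≤ n} {R : SYT k} (T : SYTWithInner hk R) {i y : ℕ}
    (h : y ∈ outerRows T i) : k < y := by
  obtain ⟨j, hj, rfl⟩ := List.mem_map.1 h
  rw [List.mem_range'_1] at hj
  by_contra hy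
  have h1 : (i, j) ∈ T.1.shape := YoungDiagram.mem_iff_lt_rowLen.2 (by omega)
  have := YoungDiagram.mem_iff_lt_rowLen.1 (T.mem_iff.2 ⟨h1, not_lt.1 hy⟩)
  omega

theorem innerTranslate_shape {hk : k ≤ n} {R Q : SYT k} (hRQ : R.shape = Q.shape)
    (T : SYTWithInner hk R) : (innerTranslate hk hRQ T).1.shape = T.1.shape := rfl

theorem innerTranslate_entry {hk : k ≤ n} {R Q : SYT k} (hRQ : R.shape = Q.shape)
    (T : SYTWithInner hk R) (i j : ℕ) : (innerTranslate hk hRQ T).1.entry i j =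
      if (i, j) ∈ Q.shape then Q.entry i j else T.1.entry i j := rfl

theorem outerRows_innerTranslate {hk : k ≤ n} {R Q : SYT k} (hRQ : R.shape = Q.shape)
    (T : SYTWithInner hk R) : outerRows (innerTranslate hk hRQ T) = outerRows T := by
  funext i
  rw [outerRows, outerRows, innerTranslate_shape, hRQ]
  refine List.map_congr_left fun j hj => ?_
  rw [List.mem_range'_1] at hj
  rw [innerTranslate_entry, if_neg]
  rw [YoungDiagram.mem_iff_lt_rowLen]
  omega

theorem innerTranslate_symm {hk : k ≤ n} {R Q : SYT k} (hRQ : R.shape = Q.shape)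
    (T : SYTWithInner hk R) : innerTranslate hk hRQ.symm (innerTranslate hk hRQ T) = T := by
  refine Subtype.ext (SYT.ext rfl ?_)
  funext i j
  rw [innerTranslate_entry, innerTranslate_entry]
  by_cases h : (i, j) ∈ R.shape
  · rw [if_pos h, T.entry_eq h]
  · rw [if_neg h, if_neg (hRQ ▸ h)]

theorem SYTWithInner.insW_small {hk : k ≤ n} {R : SYT k} (T : SYTWithInner hk R)
    {σ : Equiv.Perm (Fin n)} (h : σ ∈ knuthClass T.1) : insW (small k (word σ)) = row R.rows := by
  funext i
  rw [← filter_insW, mem_knuthClass.1 h, T.row_rows, glue, small_append,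
    small_eq_nil fun y hy => T.outerRows_gt hy, List.append_nil]
  refine List.filter_eq_self.2 fun y hy => ?_
  simpa using (SYT.mem_row.1 ⟨i, hy⟩).2

/-! ### Hook tableaux -/

/-- The first row of a tableau. -/
def SYT.hookRow (R : SYT k) : List ℕ := (List.range (R.shape.rowLen 0)).map (R.entry 0)

/-- The first column of a tableau, without the corner. -/
def SYT.hookCol (R : SYT k) : List ℕ :=
  (List.range (R.shape.colLen 0 - 1)).map fun i => R.entry (i + 1) 0

theorem SYT.row_rows_hook {R : SYT k} (hR : IsHook R.shape) :
    row R.rows = hk R.hookRow R.hookCol := by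
  funext i
  cases i with
  | zero => exact R.row_rows 0
  | succ i =>
    rw [R.row_rows, hk, SYT.hookCol]
    have h1 : R.shape.rowLen (i + 1) ≤ 1 := by
      by_contra h
      have := hR (i + 1) 1 (YoungDiagram.mem_iff_lt_rowLen.2 (not_le.1 h))
      omega
    have h2 : 0 < R.shape.rowLen (i + 1) ↔ i < R.shape.colLen 0 - 1 := by
      rw [← YoungDiagram.mem_iff_lt_rowLen, YoungDiagram.mem_iff_lt_colLen]
      omega
    by_cases h : i < R.shape.colLen 0 - 1
    · have h3 : R.shape.rowLen (i + 1) = 1 := le_antisymm h1 (h2.2 h)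
      simp [h, h3, List.range_succ]
    · have h3 : R.shape.rowLen (i + 1) = 0 := by
        have := mt h2.1 h
        omega
      simp [h, h3]

theorem SYT.isHookTableau (R : SYT k) : IsHookTableau k R.hookRow R.hookCol := by
  have hrow : ∀ {j}, j < R.shape.rowLen 0 → (0, j) ∈ R.shape := fun h =>
    YoungDiagram.mem_iff_lt_rowLen.2 h
  have hcol : ∀ {i}, i < R.shape.colLen 0 - 1 → (i + 1, 0) ∈ R.shape := fun h =>
    YoungDiagram.mem_iff_lt_colLen.2 (by omega)
  refine ⟨?_, ?_, ?_, ?_, ?_⟩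
  · refine List.pairwise_iff_getElem.2 fun a b ha hb hab => ?_
    simp only [SYT.hookRow, List.length_map, List.length_range] at hb
    simpa [SYT.hookRow] using R.row_strict hab (hrow hb)
  · refine List.pairwise_iff_getElem.2 fun a b ha hb hab => ?_
    simp only [SYT.hookCol, List.length_map, List.length_range] at hb
    simpa [SYT.hookCol] using R.col_strict (Nat.succ_lt_succ hab) (hcol hb)
  · intro c hc
    obtain ⟨i, hi, rfl⟩ := List.mem_map.1 hc
    have h := hcol (List.mem_range.1 hi)
    refine ⟨R.entry 0 0, List.mem_map.2 ⟨0, ?_, rfl⟩, R.col_strict (Nat.succ_pos i) h⟩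
    rw [List.mem_range]
    exact YoungDiagram.mem_iff_lt_rowLen.1 (R.shape.up_left_mem (Nat.zero_le _) le_rfl h)
  · intro c hc hc'
    obtain ⟨i, hi, rfl⟩ := List.mem_map.1 hc
    obtain ⟨j, hj, he⟩ := List.mem_map.1 hc'
    have := R.bijOn.injOn (hrow (List.mem_range.1 hj)) (hcol (List.mem_range.1 hi)) he
    simp at this
  · intro x hx
    rcases List.mem_append.1 hx with hx | hx
    · obtain ⟨j, hj, rfl⟩ := List.mem_map.1 hx
      exact R.entry_le (hrow (List.mem_range.1 hj))
    · obtain ⟨i, hi, rfl⟩ := List.mem_map.1 hx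
      exact R.entry_le (hcol (List.mem_range.1 hi))

theorem SYT.hookRow_ne_nil (hk : 1 ≤ k) (R : SYT k) : R.hookRow ≠ [] := by
  obtain ⟨c, hc, -⟩ := R.bijOn.surjOn (show 1 ∈ Set.Icc 1 k from ⟨le_rfl, hk⟩)
  have := YoungDiagram.mem_iff_lt_rowLen.1
    (R.shape.up_left_mem (Nat.zero_le _) (Nat.zero_le _) (show (c.1, c.2) ∈ R.shape from hc))
  simp [SYT.hookRow]
  omega

/-! ### Inner tableau translation -/

/-- The large part common to a word and its translation is the part of `T` outside `R`, which
translation of tableaux keeps. Hence the translated word lies in the Knuth class of the translated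
tableau. -/
theorem SYTWithInner.exists_translates {hkn : k ≤ n} {R Q : SYT k} (hR : IsHook R.shape)
    (hRQ : R.shape = Q.shape) (T : SYTWithInner hkn R) {σ : Equiv.Perm (Fin n)}
    (h : σ ∈ knuthClass T.1) : ∃ σ' ∈ knuthClass (innerTranslate hkn hRQ T).1,
      Translates k (hk Q.hookRow Q.hookCol) (word σ) (word σ') := by
  have hs := T.insW_small h
  rw [SYT.row_rows_hook hR] at hs
  obtain ⟨x, hx⟩ := TableauOrder.exists_translates Q.isHookTableau (hookRows_hk _ _)
    (hk_length_congr (by simp [SYT.hookRow, hRQ]) (by simp [SYT.hookCol, hRQ])) hs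
  obtain ⟨B, -, h1, h2⟩ := insW_glue hx.1 hx.2.1
  have hB : B = outerRows T := by
    funext i
    have := congrFun h1 i
    rw [mem_knuthClass.1 h, T.row_rows, T.insW_small h] at this
    exact (List.append_cancel_left this).symm
  rw [hx.2.2, hB, ← outerRows_innerTranslate hRQ, ← SYT.row_rows_hook (hRQ ▸ hR),
    ← SYTWithInner.row_rows] at h2
  obtain ⟨σ', rfl⟩ := SYT.exists_word_eq (by rw [← hx.1.length_eq, length_word]) h2
  exact ⟨σ', mem_knuthClass.2 h2, hx⟩

/-- The chain of words from `S` to `T` may leave the set of tableaux with inner tableau `R` only if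
its small letters change tableau; convexity excludes this, so the chain can be translated step by
step. -/
theorem innerTranslate_le {hkn : k ≤ n} (hk1 : 1 ≤ k) {R Q : SYT k} (hR : IsHook R.shape)
    (hRQ : R.shape = Q.shape) {S T : SYTWithInner hkn R} (h : S ≤ T) :
    innerTranslate hkn hRQ S ≤ innerTranslate hkn hRQ T := by
  rcases reflTransGen_of_le (show S.1 ≤ T.1 from h) with h | ⟨σ, hσ, τ, hτ, h⟩
  · rw [Subtype.ext h]
  · have hs := S.insW_small hσ
    have ht := T.insW_small hτ
    rw [SYT.row_rows_hook hR] at hs ht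
    obtain ⟨σ', hσ', h1⟩ := S.exists_translates hR hRQ hσ
    obtain ⟨τ', hτ', h2⟩ := T.exists_translates hR hRQ hτ
    exact le_of_reflTransGen hσ' hτ' (Translates.reflTransGen Q.isHookTableau
      (by simp [SYT.hookRow, hRQ]) (by simp [SYT.hookCol, hRQ])
      (reflTransGen_constant h hs ht (R.hookRow_ne_nil hk1)) (word_nodup σ) hs h1 h2)

/-- Inner tableau translation between hooks of the same shape is an isomorphism of orders. -/
def innerTranslateIso {hkn : k ≤ n} (hk1 : 1 ≤ k) {R Q : SYT k} (hR : IsHook R.shape)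
    (hRQ : R.shape = Q.shape) : SYTWithInner hkn R ≃o SYTWithInner hkn Q where
  toFun := innerTranslate hkn hRQ
  invFun := innerTranslate hkn hRQ.symm
  left_inv := innerTranslate_symm hRQ
  right_inv := innerTranslate_symm hRQ.symm
  map_rel_iff' {S T} := by
    refine ⟨fun h => ?_, innerTranslate_le hk1 hR hRQ⟩
    have := innerTranslate_le hk1 (hRQ ▸ hR) hRQ.symm h
    rwa [Equiv.coe_fn_mk, innerTranslate_symm, innerTranslate_symm] at this

end

end TableauOrder

theorem mainTheorem3 (n k : ℕ) (hk : 1 ≤ k) (hkn : k < n)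
    (R Q : TableauOrder.SYT k) (hR : TableauOrder.IsHook R.shape) (hRQ : R.shape = Q.shape)
    (S T : TableauOrder.SYTWithInner hkn.le R) (hST : S ⋖ T) :
    TableauOrder.innerTranslate hkn.le hRQ S ⋖ TableauOrder.innerTranslate hkn.le hRQ T :=
  (apply_covBy_apply_iff (TableauOrder.innerTranslateIso hk hR hRQ)).2 hST
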